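/- **Definitions.** For a nonzero algebraic number $\alpha$ with minimal polynomial $a\prod_{i=1}^d(z-\alpha_i)$ over $\mathbb Z$ (primitive, with complex roots $\alpha_i$), let $m(\alpha)=\log|a|+\sum_{i=1}^d\log\max\{1,|\alpha_i|\}$. For $t>0$ let $$m_t(\alpha)=\inf\left\{\Big(\sum_{k=1}^K m(\beta_k)^t\Big)^{1/t} : \beta_1,\dots,\beta_K\in\overline{\mathbb Q}^\times,\ \alpha=\beta_1\cdots\beta_K\right\}.$$ Let $h_0=0$, $h_1=1$, $h_{i+2}=h_{i+1}+h_i$ be the Fibonacci numbers. For primes $p,q$ and $n\ge1$ put $\alpha_n=p^{h_n}/q^{h_{n-1}}$. For $N\ge 3$, the pair of primes $(p,q)$ is *compatible with $N$* if $\log q/\log p$ lies strictly between $h_N/h_{N-1}$ and $h_{N-1}/h_{N-2}$, and $t_{N+1}<t_N<\cdots<t_3$, where for $n\ge3$, $t_n$ is the (unique) positive real number $t$ with $m(\alpha_n)^t=m(\alpha_{n-1})^t+m(\alpha_{n-2})^t$. Fix $N\ge1$ and let $1\le n\le N$. Define subsets of $\mathbb N_0^N$ as follows. * $\mathcal V_n$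 is the set of $x=(x_1,\dots,x_N)\in\mathbb N_0^N$ with $\sum_{i=1}^N x_ih_i=h_n$ and $\sum_{i=1}^N x_ih_{i-1}=h_{n-1}$. * $\mathcal S_1=\{(1,0,\dots,0)\}$, and for $n\ge2$, $\mathcal S_n=\{x_n(i):3\le i\le n+1\}$, where $x_n(i)$ has entry $h_{n+1-i}$ in position $i-2$, entry $h_{n+2-i}$ in position $i-1$, and zeros elsewhere. * $\mathcal C_n$ (the *almost consecutive-free* elements) is the set of $z\in\mathcal V_n$ such that, for every $1\le j<N$, $z_jz_{j+1}\ne0$ implies $z_i=0$ for all $i>j+1$. * A *factorization* of $z\in\mathcal V_n$ is a tuple $(x_1,\dots,x_K)$ of elements of $\bigcup_{i=1}^n\mathcal V_i$ with $z=\sum_{k=1}^K x_k$; it is *trivial* if it is $(z)$. $\mathcal R_n$ (the *$\mathcal S$-restricted* elements) is the set of $z\in\mathcal C_n$ such that every member of every non-trivial factorization of $z$ lies in $\bigcup_{i=1}^n\mathcal S_i$. For $x\in\mathbb N_0^N$ and $t>0$ let $f_x(t)=\big(\sum_{i=1}^N x_i\,m(\alpha_i)^t\big)^{1/t}$. **Theorem.**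 Let $n,N$ be positive integers with $1\le n\le N$. Then $$\mathcal S_n\subseteq\mathcal R_n\subseteq\mathcal C_n\subseteq\mathcal V_n.$$ Moreover, if $(p,q)$ is a pair of primes compatible with $N$ (so $N\ge3$), then: (i) $m_t(\alpha_n)=\min\{f_x(t):x\in\mathcal C_n\}$ for all $t>0$. (ii) If $m_t(\alpha_i)=\min\{f_x(t):x\in\mathcal S_i\}$ for all $1\le i<n$ and all $t>0$, then $m_t(\alpha_n)=\min\{f_x(t):x\in\mathcal R_n\}$ for all $t>0$. -/

import Mathlib

noncomputable section

namespace FibMahler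

open Polynomial

/-- The minimal polynomial of an algebraic number `α` over `ℤ`: the primitive integer polynomial
(unique up to sign) proportional to the monic minimal polynomial of `α` over `ℚ`. -/
def intMinpoly (α : ℂ) : ℤ[X] :=
  (IsLocalization.integerNormalization (nonZeroDivisors ℤ) (minpoly ℚ α)).primPart

/-- The logarithmic Mahler measure `m(α) = log |a| + ∑ log max {1, |αᵢ|}` of an algebraic number,
where `a ∏ (z - αᵢ)` is its minimal polynomial over `ℤ`. -/
def mahler (α : ℂ) : ℝ :=
  Real.log |((intMinpoly α).leadingCoeff : ℝ)| +
    (((intMinpoly α).map (Int.castRingHom ℂ)).roots.map fun z => Real.log (max 1 ‖z‖)).sum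

/-- The product representations of `α`: finite tuples of nonzero algebraic numbers with
product `α`. -/
def productReps (α : ℂ) : Set (List ℂ) :=
  {l | (∀ β ∈ l, β ≠ 0 ∧ IsAlgebraic ℚ β) ∧ l.prod = α}

/-- The measure function `f(t) = (∑ m(αᵢ) ^ t) ^ (1 / t)` of a tuple. -/
def measureFn (l : List ℂ) (t : ℝ) : ℝ :=
  (l.map fun β => mahler β ^ t).sum ^ (1 / t)

/-- The `t`-metric Mahler measure `m_t(α)`, the infimum of `f(t)` over the product representations
of `α`. -/
def metricMahler (t : ℝ) (α : ℂ) : ℝ :=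
  sInf ((fun l => measureFn l t) '' productReps α)

/-- `α_n = p ^ h_n / q ^ h_{n-1}` for `n ≥ 1`, where `h` is the Fibonacci sequence. -/
def fibNum (p q n : ℕ) : ℂ :=
  (p : ℂ) ^ Nat.fib n / (q : ℂ) ^ Nat.fib (n - 1)

/-- `t_n` for `n ≥ 3`, the positive real number `t` with `m(α_n)^t = m(α_{n-1})^t + m(α_{n-2})^t`.
For primes `p`, `q` with `log q / log p` strictly between two consecutive Fibonacci ratios as in
`Compatible`, there is exactly one such `t`, so that the infimum is that of a singleton. -/
def crossing (p q n : ℕ) : ℝ :=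
  sInf {t : ℝ | 0 < t ∧
    mahler (fibNum p q n) ^ t = mahler (fibNum p q (n - 1)) ^ t + mahler (fibNum p q (n - 2)) ^ t}

/-- The pair `(p, q)` is compatible with `N ≥ 3`: the number `log q / log p` lies strictly between
`h_N / h_{N-1}` and `h_{N-1} / h_{N-2}`, and `t_{N+1} < t_N < ⋯ < t_3`. -/
def Compatible (N p q : ℕ) : Prop :=
  3 ≤ N ∧ p.Prime ∧ q.Prime ∧
    (((Nat.fib N : ℝ) / Nat.fib (N - 1) < Real.log q / Real.log p ∧
        Real.log q / Real.log p < (Nat.fib (N - 1) : ℝ) / Nat.fib (N - 2)) ∨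
      ((Nat.fib (N - 1) : ℝ) / Nat.fib (N - 2) < Real.log q / Real.log p ∧
        Real.log q / Real.log p < (Nat.fib N : ℝ) / Nat.fib (N - 1))) ∧
    ∀ n, 3 ≤ n → n ≤ N → crossing p q (n + 1) < crossing p q n

/-- The `2 × N` matrix with rows `(h_1, …, h_N)` and `(h_0, …, h_{N-1})`. The coordinate number `j`
of a vector, `1 ≤ j ≤ N`, has index `j - 1` in `Fin N`. -/
def fibMatrix (N : ℕ) : Matrix (Fin 2) (Fin N) ℕ :=
  Matrix.of ![fun i => Nat.fib (i + 1), fun i => Nat.fib i]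

/-- `𝓥_n`, the vectors `x` of `N` non-negative integers with `A x = (h_n, h_{n-1})`. -/
def setV (N n : ℕ) : Set (Fin N → ℕ) :=
  {x | (fibMatrix N).mulVec x = ![Nat.fib n, Nat.fib (n - 1)]}

/-- The product representation attached to the vector `x`: the number `α_i` is taken `x_i` times. -/
def vecRep {N : ℕ} (p q : ℕ) (x : Fin N → ℕ) : List ℂ :=
  (List.finRange N).flatMap fun i => List.replicate (x i) (fibNum p q (i + 1))

/-- The measure function `f_x` of a vector `x`. -/
def vecMeasureFn {N : ℕ} (p q : ℕ) (x : Fin N → ℕ) (t : ℝ) : ℝ :=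
  measureFn (vecRep p q x) t

/-- `x_n(i)`, the vector with coordinate `h_{n+1-i}` at position `i - 2`, coordinate `h_{n+2-i}` at
position `i - 1`, and all other coordinates zero (positions are counted from `1`). -/
def vecX (N n i : ℕ) : Fin N → ℕ := fun k =>
  if (k : ℕ) + 3 = i then Nat.fib (n + 1 - i)
  else if (k : ℕ) + 2 = i then Nat.fib (n + 2 - i)
  else 0

/-- `𝓢_1 = {x_1(2)}` with `x_1(2) = (1, 0, …, 0)`, and `𝓢_n = {x_n(i) : 3 ≤ i ≤ n + 1}` for
`n ≥ 2`. -/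
def setS (N n : ℕ) : Set (Fin N → ℕ) :=
  if n = 1 then {vecX N 1 2} else vecX N n '' Set.Icc 3 (n + 1)

/-- `𝓒_n`, the almost consecutive-free elements of `𝓥_n`: if `z_j z_{j+1} ≠ 0` then `z_i = 0` for
all `i > j + 1`. -/
def setC (N n : ℕ) : Set (Fin N → ℕ) :=
  {z | z ∈ setV N n ∧ ∀ j j' : Fin N, (j' : ℕ) = (j : ℕ) + 1 → z j * z j' ≠ 0 →
    ∀ i : Fin N, j' < i → z i = 0}

/-- The tuple `l` of elements of `𝓥_1 ∪ ⋯ ∪ 𝓥_n` is a factorization of `z`, that is, has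
sum `z`. -/
def IsFactorization {N : ℕ} (n : ℕ) (z : Fin N → ℕ) (l : List (Fin N → ℕ)) : Prop :=
  (∀ x ∈ l, ∃ i, 1 ≤ i ∧ i ≤ n ∧ x ∈ setV N i) ∧ l.sum = z

/-- `𝓡_n`, the `𝓢`-restricted elements of `𝓒_n`: every factorization other than the trivial
one `(z)` has all its members in `𝓢_1 ∪ ⋯ ∪ 𝓢_n`. -/
def setR (N n : ℕ) : Set (Fin N → ℕ) :=
  {z | z ∈ setC N n ∧ ∀ l : List (Fin N → ℕ), IsFactorization n z l → l ≠ [z] →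
    ∀ x ∈ l, ∃ i, 1 ≤ i ∧ i ≤ n ∧ x ∈ setS N i}

/-- `m_t(α_n)` is the minimum of `f_x(t)` over `x` in `X`, for every `t > 0`. -/
def MinOver {N : ℕ} (p q n : ℕ) (X : Set (Fin N → ℕ)) : Prop :=
  ∀ t : ℝ, 0 < t →
    IsLeast ((fun x => vecMeasureFn p q x t) '' X) (metricMahler t (fibNum p q n))

end FibMahler

end

/-!
The inclusion `𝓢_n ⊆ 𝓡_n` is linear algebra over `ℕ`: an element of `𝓢_n` is supported on two
consecutive positions, hence so is every member of a factorization of it, and consecutive vectors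
`(h_{j+1}, h_j)`, `(h_{j+2}, h_{j+1})` form a basis of `ℤ²`, so such a member lies in some `𝓢_k`
(`mem_setS_of_support`).

For the minima, let `P_t(x) = f_x(t) ^ t = ∑ x_i m(α_i) ^ t`.

*Reduction to `𝓥_n`* (`Compatible.exists_powerSum_le_of_mem_productReps`). Let `α_n = β_1 ⋯ β_K`, and
let `a_k`, `b_k` be the leading and constant coefficients of the integral minimal polynomial of
`β_k`. Taking norms to `ℚ` and comparing valuations gives `h_n ≤ ∑ v_p(b_k)` and
`h_{n-1} ≤ ∑ v_q(a_k)`, while `m(β_k) ≥ max (v_p(b_k) log p) (v_q(a_k) log q)`. If `t ≤ 1`,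
subadditivity of `u ↦ u ^ t` shows that the trivial representation is at least as good. If `t ≥ 1`,
the valuations are trimmed to integer points `(e_k, f_k)`, `f_k ≤ e_k`, with sum `(h_n, h_{n-1})`.
Each of these is a combination of two points `(h_{i+1}, h_i)`, `(h_{i+3}, h_{i+2})`
(`exists_fib_combination`). Compatibility puts those on the same side of the line
`e log p = f log q`, where the cost `max (e log p) (f log q)` is additive, so superadditivity of
`u ↦ u ^ t` shows that splitting does not increase the power sum.

*Minimizers on `𝓥_n`* (`exists_powerSum_le`). The numbers `m(α_i)` are distinct, so for `t` near a
given `t₀`, other than `t₀` itself, distinct vectors of the finite set `𝓥_n` have distinct power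
sums. To find a minimizer in a subset `X` for every `t`, it therefore suffices that each
`z ∈ 𝓥_n` outside `X` can be exchanged, for every `t`, for another vector of `𝓥_n` whose power sum is
not larger: this settles the generic `t`, and continuity the others.

*Exchanges*. If `z ∉ 𝓒_n`, then `z` involves `α_j`, `α_{j+1}` and some `α_i` with `i ≥ j + 2`. When
`t ≤ t_{j+2}` one merges `α_j α_{j+1}` into `α_{j+2}`; otherwise `t ≥ t_{j+2} ≥ t_i`, and one splits
`α_i` into `α_{i-1} α_{i-2}` (`Compatible.exists_le_of_not_mem_setC`). If `z ∈ 𝓒_n` is not in `𝓡_n`, a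
member of a factorization that is not in the corresponding `𝓢_i` is exchanged for a minimizer in
`𝓢_i` (`Compatible.exists_le_of_not_mem_setR`).
-/

open Polynomial

namespace FibMahler

open Filter Topology

/-! ### Minimal polynomials over the integers and Mahler measures -/

lemma map_intMinpoly (β : ℂ) (hβ : IsAlgebraic ℚ β) :
    ∃ c : ℚ, c ≠ 0 ∧ (intMinpoly β).map (Int.castRingHom ℚ) = C c * minpoly ℚ β := by
  set Q := IsLocalization.integerNormalization (nonZeroDivisors ℤ) (minpoly ℚ β) with hQ
  have hQ0 : Q ≠ 0 := by
    rw [hQ, Ne, IsFractionRing.integerNormalization_eq_zero_iff]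
    exact minpoly.ne_zero hβ.isIntegral
  obtain ⟨b, hbM, hb⟩ := IsLocalization.integerNormalization_spec
    (nonZeroDivisors ℤ) (minpoly ℚ β)
  have hb0 : (b : ℚ) ≠ 0 := by
    exact_mod_cast nonZeroDivisors.ne_zero hbM
  have hc0 : (Q.content : ℚ) ≠ 0 := by
    exact_mod_cast (fun h => hQ0 (content_eq_zero_iff.1 h))
  refine ⟨b / Q.content, div_ne_zero hb0 hc0, ?_⟩
  have h1 : Q.map (Int.castRingHom ℚ) = C (b : ℚ) * minpoly ℚ β := by
    rw [hQ]
    have : (algebraMap ℤ ℚ) = Int.castRingHom ℚ := rfl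
    rw [← this, hb]
    ext i
    simp
  have h2 : Q.map (Int.castRingHom ℚ)
      = C (Q.content : ℚ) * (intMinpoly β).map (Int.castRingHom ℚ) := by
    conv_lhs => rw [eq_C_content_mul_primPart Q]
    rw [Polynomial.map_mul, map_C]
    rfl
  have h3 : C ((Q.content : ℚ)⁻¹) * C (Q.content : ℚ) = 1 := by
    rw [← C_mul, inv_mul_cancel₀ hc0, C_1]
  calc (intMinpoly β).map (Int.castRingHom ℚ)
      = C ((Q.content : ℚ)⁻¹) * (C (Q.content : ℚ) * (intMinpoly β).map (Int.castRingHom ℚ)) := by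
        rw [← mul_assoc, h3, one_mul]
    _ = _ := by
        rw [← h2, h1, ← mul_assoc, ← C_mul, div_eq_inv_mul]

lemma intMinpoly_ne_zero (β : ℂ) (hβ : IsAlgebraic ℚ β) : intMinpoly β ≠ 0 := by
  obtain ⟨c, hc, h⟩ := map_intMinpoly β hβ
  intro h0
  rw [h0, Polynomial.map_zero] at h
  exact mul_ne_zero (C_ne_zero.2 hc) (minpoly.ne_zero hβ.isIntegral) h.symm

lemma natDegree_intMinpoly (β : ℂ) (hβ : IsAlgebraic ℚ β) :
    (intMinpoly β).natDegree = (minpoly ℚ β).natDegree := by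
  obtain ⟨c, hc, h⟩ := map_intMinpoly β hβ
  rw [← natDegree_map_eq_of_injective (RingHom.injective_int (Int.castRingHom ℚ)), h,
    natDegree_C_mul hc]

lemma minpoly_coeff_eq_div (β : ℂ) (hβ : IsAlgebraic ℚ β) (i : ℕ) :
    (minpoly ℚ β).coeff i = ((intMinpoly β).coeff i : ℚ) / ((intMinpoly β).leadingCoeff : ℚ) := by
  obtain ⟨c, hc, h⟩ := map_intMinpoly β hβ
  have key : ∀ j, ((intMinpoly β).coeff j : ℚ) = c * (minpoly ℚ β).coeff j := fun j => by
    have := congrArg (fun P => P.coeff j) h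
    simpa using this
  have hl : ((intMinpoly β).leadingCoeff : ℚ) = c := by
    rw [leadingCoeff, key, natDegree_intMinpoly β hβ, coeff_natDegree,
      (minpoly.monic hβ.isIntegral).leadingCoeff, mul_one]
  rw [hl, key, mul_div_cancel_left₀ _ hc]

lemma intMinpoly_coeff_zero_ne_zero (β : ℂ) (hβ : IsAlgebraic ℚ β) (h0 : β ≠ 0) :
    (intMinpoly β).coeff 0 ≠ 0 := by
  intro h
  have := minpoly_coeff_eq_div β hβ 0
  rw [h, Int.cast_zero, zero_div] at this
  exact h0 ((minpoly.coeff_zero_eq_zero hβ.isIntegral).1 this)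

lemma sum_log_max_one_nonneg (s : Multiset ℂ) :
    0 ≤ (s.map fun z => Real.log (max 1 ‖z‖)).sum := by
  apply Multiset.sum_nonneg
  simp only [Multiset.mem_map]
  rintro _ ⟨z, -, rfl⟩
  exact Real.log_nonneg (le_max_left _ _)

lemma log_norm_prod_le (s : Multiset ℂ) (hs : 0 ∉ s) :
    Real.log ‖s.prod‖ ≤ (s.map fun z => Real.log (max 1 ‖z‖)).sum := by
  induction s using Multiset.induction_on with
  | empty => simp
  | cons a s ih =>
    have h1 : a ≠ 0 := fun h => hs (by simp [h])
    have h2 : (0 : ℂ) ∉ s := fun h => hs (by simp [h])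
    rw [Multiset.prod_cons, norm_mul, Multiset.map_cons, Multiset.sum_cons,
      Real.log_mul (norm_ne_zero_iff.2 h1) (norm_ne_zero_iff.2 (Multiset.prod_ne_zero h2))]
    exact add_le_add (Real.log_le_log (norm_pos_iff.2 h1) (le_max_right _ _)) (ih h2)

lemma log_leadingCoeff_le_mahler (β : ℂ) :
    Real.log |((intMinpoly β).leadingCoeff : ℝ)| ≤ mahler β :=
  le_add_of_nonneg_right (sum_log_max_one_nonneg _)

lemma log_abs_intCast_nonneg (a : ℤ) : 0 ≤ Real.log |(a : ℝ)| := by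
  rw [← Int.cast_abs, ← Nat.cast_natAbs]
  exact Real.log_natCast_nonneg _

lemma mahler_nonneg (β : ℂ) : 0 ≤ mahler β :=
  (log_abs_intCast_nonneg _).trans (log_leadingCoeff_le_mahler β)

lemma log_coeff_zero_le_mahler (β : ℂ) (hβ : IsAlgebraic ℚ β) (h0 : β ≠ 0) :
    Real.log |((intMinpoly β).coeff 0 : ℝ)| ≤ mahler β := by
  set P := (intMinpoly β).map (Int.castRingHom ℂ) with hP
  have hinj : Function.Injective (Int.castRingHom ℂ) := RingHom.injective_int _
  have hc0 := intMinpoly_coeff_zero_ne_zero β hβ h0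
  have hP0 : P ≠ 0 := (Polynomial.map_ne_zero_iff hinj).2 (intMinpoly_ne_zero β hβ)
  have hlead : P.leadingCoeff = ((intMinpoly β).leadingCoeff : ℂ) :=
    leadingCoeff_map_of_injective hinj _
  have hcoeff : P.coeff 0 = ((intMinpoly β).coeff 0 : ℂ) := by simp [hP]
  have hroots : (0 : ℂ) ∉ P.roots := by
    rw [mem_roots hP0, IsRoot, ← coeff_zero_eq_eval_zero, hcoeff]
    exact_mod_cast hc0
  have hprod := (IsAlgClosed.splits P).coeff_zero_eq_leadingCoeff_mul_prod_roots
  have hnorm : |((intMinpoly β).coeff 0 : ℝ)|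
      = |((intMinpoly β).leadingCoeff : ℝ)| * ‖P.roots.prod‖ := by
    have := congrArg norm hprod
    rw [hcoeff, hlead] at this
    simpa using this
  rw [hnorm, Real.log_mul]
  · exact add_le_add le_rfl (log_norm_prod_le _ hroots)
  · simpa using intMinpoly_ne_zero β hβ
  · exact norm_ne_zero_iff.2 (Multiset.prod_ne_zero hroots)

lemma padicValInt_mul_log_le {p : ℕ} [Fact p.Prime] {a : ℤ} (ha : a ≠ 0) :
    (padicValInt p a : ℝ) * Real.log p ≤ Real.log |(a : ℝ)| := by
  rw [← Real.log_pow]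
  have hp : 0 < p := (Fact.out : p.Prime).pos
  apply Real.log_le_log (by positivity)
  have h : p ^ padicValInt p a ≤ a.natAbs :=
    Nat.le_of_dvd (Int.natAbs_pos.2 ha) pow_padicValNat_dvd
  rw [← Int.cast_abs, ← Nat.cast_natAbs]
  exact_mod_cast h

/-- The norm of an element is, up to sign, a power of the constant term of the minimal
polynomial, so its valuation is a bounded multiple of `v(a₀) - v(a)`. -/
lemma padicValRat_norm (E : IntermediateField ℚ ℂ) [FiniteDimensional ℚ E] (p : ℕ) [Fact p.Prime]
    (x : E) (hx : x ≠ 0) :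
    ∃ r : ℕ, r ≤ Module.finrank ℚ E ∧ padicValRat p (Algebra.norm ℚ x) =
      r * ((padicValInt p ((intMinpoly (x : ℂ)).coeff 0) : ℤ)
        - padicValInt p (intMinpoly (x : ℂ)).leadingCoeff) := by
  have hint : IsIntegral ℚ x := Algebra.IsIntegral.isIntegral x
  have halg : IsAlgebraic ℚ (x : ℂ) := (hint.map E.val).isAlgebraic
  have hx0 : (x : ℂ) ≠ 0 := by simpa using hx
  have hmin : minpoly ℚ x = minpoly ℚ (x : ℂ) :=
    (minpoly.algebraMap_eq (algebraMap E ℂ).injective x).symm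
  refine ⟨Module.finrank (IntermediateField.adjoin ℚ {x}) E, ?_, ?_⟩
  · rw [← Module.finrank_mul_finrank ℚ (IntermediateField.adjoin ℚ {x}) E]
    exact Nat.le_mul_of_pos_left _ Module.finrank_pos
  · rw [Algebra.norm_eq_norm_adjoin]
    have h1 := Algebra.PowerBasis.norm_gen_eq_coeff_zero_minpoly
      (IntermediateField.adjoin.powerBasis hint)
    rw [IntermediateField.adjoin.powerBasis_gen, IntermediateField.minpoly_gen,
      hmin, minpoly_coeff_eq_div _ halg] at h1
    rw [h1, padicValRat.pow]
    congr 1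
    have ha : ((intMinpoly (x : ℂ)).coeff 0 : ℚ) ≠ 0 :=
      Int.cast_ne_zero.2 (intMinpoly_coeff_zero_ne_zero _ halg hx0)
    have hb : ((intMinpoly (x : ℂ)).leadingCoeff : ℚ) ≠ 0 :=
      Int.cast_ne_zero.2 (leadingCoeff_ne_zero.2 (intMinpoly_ne_zero _ halg))
    rcases neg_one_pow_eq_or ℚ (IntermediateField.adjoin.powerBasis hint).dim with h | h <;>
      rw [h] <;> simp only [one_mul, neg_one_mul, padicValRat.neg] <;>
      rw [padicValRat.div ha hb, padicValRat.of_int, padicValRat.of_int]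

/-- Comparing valuations of norms: the constant terms of the minimal polynomials of the factors of
a rational number `r` absorb its numerator, and their leading coefficients its denominator. -/
lemma padicValRat_le_sum_of_prod_eq {l : List ℂ} (hl : ∀ β ∈ l, β ≠ 0 ∧ IsAlgebraic ℚ β) {r : ℚ}
    (hr : l.prod = r) (p : ℕ) [Fact p.Prime] :
    padicValRat p r ≤ ((l.map fun β => padicValInt p ((intMinpoly β).coeff 0)).sum : ℕ) ∧
      -padicValRat p r ≤ ((l.map fun β => padicValInt p (intMinpoly β).leadingCoeff).sum : ℕ) := by
  let E : IntermediateField ℚ ℂ := IntermediateField.adjoin ℚ {x | x ∈ l}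
  have hfin : Finite {x | x ∈ l} := l.finite_toSet
  have : FiniteDimensional ℚ E :=
    IntermediateField.finiteDimensional_adjoin fun x hx => (hl x hx).2.isIntegral
  have hmem : ∀ β ∈ l, β ∈ E := fun β hβ => IntermediateField.subset_adjoin ℚ _ hβ
  clear_value E
  lift l to List E using hmem
  set D := Module.finrank ℚ E
  have hD : 0 < D := Module.finrank_pos
  have hl0 : ∀ β ∈ l, β ≠ 0 := fun β hβ => by
    have := (hl β (List.mem_map_of_mem hβ)).1
    simpa using this
  have hprod : l.prod = algebraMap ℚ E r := by
    apply Subtype.val_injective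
    have h1 : ((l.prod : E) : ℂ) = (l.map (fun x : E => (x : ℂ))).prod :=
      map_list_prod E.val l
    rw [h1, hr]
    simp
  have hnorm : padicValRat p (Algebra.norm ℚ l.prod) = D * padicValRat p r := by
    rw [hprod, Algebra.norm_algebraMap, padicValRat.pow]
  have key : padicValRat p (Algebra.norm ℚ l.prod) ≤
        D * ((l.map fun β : E => padicValInt p ((intMinpoly (β : ℂ)).coeff 0)).sum : ℕ) ∧
      -padicValRat p (Algebra.norm ℚ l.prod) ≤
        D * ((l.map fun β : E => padicValInt p (intMinpoly (β : ℂ)).leadingCoeff).sum : ℕ) := by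
    clear hnorm hprod hr hl hfin
    induction l with
    | nil => simp
    | cons a l ih =>
      have ha := hl0 a (by simp)
      obtain ⟨ih1, ih2⟩ := ih fun β hβ => hl0 β (by simp [hβ])
      have hp0 : l.prod ≠ 0 := List.prod_ne_zero fun h => hl0 0 (by simp [h]) rfl
      obtain ⟨s, hs, hsv⟩ := padicValRat_norm E p a ha
      rw [List.prod_cons, map_mul, padicValRat.mul (Algebra.norm_ne_zero_iff.2 ha)
        (Algebra.norm_ne_zero_iff.2 hp0), hsv]
      simp only [List.map_cons, List.sum_cons, Nat.cast_add, mul_add]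
      have hs' : (s : ℤ) ≤ D := by exact_mod_cast hs
      have hu : ∀ u : ℕ, (s : ℤ) * u ≤ D * u ∧ 0 ≤ (s : ℤ) * u := fun u =>
        ⟨mul_le_mul_of_nonneg_right hs' (by positivity), by positivity⟩
      have e1 := hu (padicValInt p ((intMinpoly (a : ℂ)).coeff 0))
      have e2 := hu (padicValInt p (intMinpoly (a : ℂ)).leadingCoeff)
      rw [mul_sub]
      constructor <;> linarith [e1.1, e1.2, e2.1, e2.2]
  rw [hnorm] at key
  simp only [List.map_map, Function.comp_def]
  have hD' : (0 : ℤ) < D := by exact_mod_cast hD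
  refine ⟨le_of_mul_le_mul_left key.1 hD', le_of_mul_le_mul_left ?_ hD'⟩
  linarith [key.2]

/-- The Mahler measure of a rational number `a / b` in lowest terms is `log max {a, b}`. -/
lemma mahler_natCast_div {a b : ℕ} (ha : 0 < a) (hb : 0 < b) (hab : a.Coprime b) :
    mahler ((a : ℂ) / b) = max (Real.log a) (Real.log b) := by
  set r : ℂ := (a : ℂ) / b with hr
  have hrq : r = algebraMap ℚ ℂ ((a : ℚ) / b) := by simp [hr]
  have halg : IsAlgebraic ℚ r := by rw [hrq]; exact isAlgebraic_algebraMap _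
  have hmin : minpoly ℚ r = X - C ((a : ℚ) / b) := by rw [hrq]; exact minpoly.eq_X_sub_C _ _
  set P := intMinpoly r with hP
  have hdeg : P.natDegree = 1 := by
    rw [hP, natDegree_intMinpoly r halg, hmin, natDegree_X_sub_C]
  have hlc : P.leadingCoeff = P.coeff 1 := by rw [leadingCoeff, hdeg]
  have hP0 : P ≠ 0 := intMinpoly_ne_zero r halg
  have hl0 : P.coeff 1 ≠ 0 := by rw [← hlc]; exact leadingCoeff_ne_zero.2 hP0
  have hPeq : P = C (P.coeff 1) * X + C (P.coeff 0) :=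
    eq_X_add_C_of_natDegree_le_one hdeg.le
  have hprim : P.IsPrimitive := isPrimitive_primPart _
  have hgcd : IsCoprime (P.coeff 0) (P.coeff 1) := by
    refine isCoprime_of_dvd _ _ (fun h => hl0 h.2) fun d hd _ hd0 hd1 => hd ?_
    refine isPrimitive_iff_isUnit_of_C_dvd.1 hprim d ?_
    rw [hPeq]
    exact dvd_add ((map_dvd C hd1).mul_right _) (map_dvd C hd0)
  have hrel : (P.coeff 0) * b = - (a * P.coeff 1) := by
    have := minpoly_coeff_eq_div r halg 0
    rw [hmin, ← hP, hlc] at this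
    simp only [coeff_sub, coeff_X_zero, coeff_C_zero, zero_sub] at this
    have hb' : (b : ℚ) ≠ 0 := by positivity
    have hl' : (P.coeff 1 : ℚ) ≠ 0 := by exact_mod_cast hl0
    field_simp at this
    have h2 : (P.coeff 0 : ℚ) * b = - (a * P.coeff 1) := by linarith
    exact_mod_cast h2
  have hnat : (P.coeff 0).natAbs * b = a * (P.coeff 1).natAbs := by
    have := congrArg Int.natAbs hrel
    simpa [Int.natAbs_mul] using this
  have hcop : (P.coeff 0).natAbs.Coprime (P.coeff 1).natAbs := Int.isCoprime_iff_nat_coprime.1 hgcd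
  have hb1 : (P.coeff 1).natAbs = b := by
    apply Nat.dvd_antisymm
    · exact hcop.symm.dvd_of_dvd_mul_left ⟨a, by rw [hnat, mul_comm]⟩
    · exact hab.symm.dvd_of_dvd_mul_left ⟨(P.coeff 0).natAbs, by rw [← hnat, mul_comm]⟩
  have hroots : (P.map (Int.castRingHom ℂ)).roots = {r} := by
    obtain ⟨c, hc, hmap⟩ := map_intMinpoly r halg
    have h1 := congrArg (Polynomial.map (algebraMap ℚ ℂ)) hmap
    rw [Polynomial.map_map, hmin, Polynomial.map_mul, map_C, Polynomial.map_sub, map_X, map_C,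
      ← hrq, ← hP] at h1
    have h2 : (algebraMap ℚ ℂ).comp (Int.castRingHom ℚ) = Int.castRingHom ℂ := RingHom.ext_int _ _
    rw [h2] at h1
    rw [h1, roots_C_mul _ (by simpa using hc), roots_X_sub_C]
  have hlead : |(P.leadingCoeff : ℝ)| = b := by
    rw [hlc, ← Int.cast_abs, ← Nat.cast_natAbs, hb1]
  have hnr : ‖r‖ = (a : ℝ) / b := by simp [hr]
  have ha' : (0 : ℝ) < a := by exact_mod_cast ha
  have hb' : (0 : ℝ) < b := by exact_mod_cast hb
  rw [mahler, ← hP, hroots, hlead, Multiset.map_singleton, Multiset.sum_singleton, hnr,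
    ← Real.log_mul hb'.ne' (by positivity), mul_max_of_nonneg _ _ hb'.le, mul_one,
    mul_div_cancel₀ _ hb'.ne', max_comm,
    (Real.strictMonoOn_log.monotoneOn).map_max ha' hb']

/-! ### Vectors supported on two consecutive positions and factorizations -/

lemma mem_setV {N n : ℕ} {x : Fin N → ℕ} :
    x ∈ setV N n ↔ ∑ i : Fin N, Nat.fib (i + 1) * x i = Nat.fib n ∧
      ∑ i : Fin N, Nat.fib i * x i = Nat.fib (n - 1) := by
  simp [setV, fibMatrix, funext_iff, Fin.forall_fin_two, dotProduct]

lemma le_fib_of_mem_setV {N n : ℕ} {x : Fin N → ℕ} (hx : x ∈ setV N n) (i : Fin N) :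
    x i ≤ Nat.fib n := by
  rw [← (mem_setV.1 hx).1]
  calc x i ≤ Nat.fib (i + 1) * x i := Nat.le_mul_of_pos_left _ (Nat.fib_pos.2 (Nat.succ_pos _))
    _ ≤ _ := Finset.single_le_sum (f := fun i : Fin N => Nat.fib (i + 1) * x i)
      (fun _ _ => Nat.zero_le _) (Finset.mem_univ i)

lemma setV_finite (N n : ℕ) : (setV N n).Finite :=
  (Set.finite_Icc (0 : Fin N → ℕ) fun _ => Nat.fib n).subset fun _ hx =>
    ⟨fun _ => Nat.zero_le _, fun i => le_fib_of_mem_setV hx i⟩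

lemma setC_subset_setV (N n : ℕ) : setC N n ⊆ setV N n := fun _ h => h.1

lemma setR_subset_setC (N n : ℕ) : setR N n ⊆ setC N n := fun _ h => h.1

/-- Two consecutive vectors `(h_{j+1}, h_j)` and `(h_{j+2}, h_{j+1})` are linearly independent. -/
lemma fib_combination_unique {a b c d : ℕ} (j : ℕ)
    (h1 : Nat.fib (j + 1) * a + Nat.fib (j + 2) * b = Nat.fib (j + 1) * c + Nat.fib (j + 2) * d)
    (h2 : Nat.fib j * a + Nat.fib (j + 1) * b = Nat.fib j * c + Nat.fib (j + 1) * d) :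
    a = c ∧ b = d := by
  induction j with
  | zero => simp at h1 h2; omega
  | succ j ih =>
    refine ih h2 ?_
    have e1 : Nat.fib (j + 1 + 1) = Nat.fib j + Nat.fib (j + 1) := Nat.fib_add_two
    have e2 : Nat.fib (j + 1 + 2) = Nat.fib (j + 1) + Nat.fib (j + 1 + 1) := Nat.fib_add_two
    rw [e2] at h1
    nlinarith

/-- The vector `x_n(i)` is characterised in `𝓥_n` by its support. -/
lemma eq_vecX_of_mem_setV {N j m : ℕ} (hN : j + 1 < N) {x : Fin N → ℕ}
    (hx : x ∈ setV N (j + 2 + m)) (hsupp : ∀ k : Fin N, (k : ℕ) ≠ j → (k : ℕ) ≠ j + 1 → x k = 0) :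
    x = vecX N (j + 2 + m) (j + 3) := by
  let a : Fin N := ⟨j, by omega⟩
  let b : Fin N := ⟨j + 1, hN⟩
  have hab : a ≠ b := by simp [a, b]
  have hsum : ∀ g : ℕ → ℕ, ∑ k : Fin N, g k * x k = g j * x a + g (j + 1) * x b := fun g =>
    Fintype.sum_eq_add a b hab fun k hk => by
      rw [hsupp k (fun h => hk.1 (Fin.ext h)) (fun h => hk.2 (Fin.ext h)), mul_zero]
  obtain ⟨h1, h2⟩ := mem_setV.1 hx
  rw [hsum fun k => Nat.fib (k + 1)] at h1
  rw [hsum fun k => Nat.fib k] at h2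
  have key : x a = Nat.fib m ∧ x b = Nat.fib (m + 1) := by
    apply fib_combination_unique j
    · rw [h1, show j + 2 + m = j + 1 + m + 1 by omega, Nat.fib_add]
    · rw [h2, show j + 2 + m - 1 = j + m + 1 by omega, Nat.fib_add]
  funext k
  by_cases hka : (k : ℕ) = j
  · have : k = a := Fin.ext hka
    rw [this, key.1]
    simp [vecX, a, show j + 2 + m + 1 - (j + 3) = m by omega]
  by_cases hkb : (k : ℕ) = j + 1
  · have : k = b := Fin.ext hkb
    rw [this, key.2]
    simp [vecX, b, show j + 2 + m + 2 - (j + 3) = m + 1 by omega]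
  rw [hsupp k hka hkb, vecX, if_neg (by omega), if_neg (by omega)]

lemma vecX_mem_setV {N j m : ℕ} (hN : j + 1 < N) : vecX N (j + 2 + m) (j + 3) ∈ setV N (j + 2 + m) := by
  let a : Fin N := ⟨j, by omega⟩
  let b : Fin N := ⟨j + 1, hN⟩
  have hab : a ≠ b := by simp [a, b]
  have hsum : ∀ g : ℕ → ℕ, ∑ k : Fin N, g k * vecX N (j + 2 + m) (j + 3) k
      = g j * Nat.fib m + g (j + 1) * Nat.fib (m + 1) := fun g => by
    rw [Fintype.sum_eq_add a b hab]
    · simp [vecX, a, b, show j + 2 + m + 1 - (j + 3) = m by omega,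
        show j + 2 + m + 2 - (j + 3) = m + 1 by omega]
    · intro k hk
      have h1 : (k : ℕ) ≠ j := fun h => hk.1 (Fin.ext h)
      have h2 : (k : ℕ) ≠ j + 1 := fun h => hk.2 (Fin.ext h)
      rw [vecX, if_neg (by omega), if_neg (by omega), mul_zero]
  have e1 : Nat.fib (j + 2 + m)
      = Nat.fib (j + 1) * Nat.fib m + Nat.fib (j + 2) * Nat.fib (m + 1) := by
    rw [show j + 2 + m = j + 1 + m + 1 by omega, Nat.fib_add]
  have e2 : Nat.fib (j + 2 + m - 1)
      = Nat.fib j * Nat.fib m + Nat.fib (j + 1) * Nat.fib (m + 1) := by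
    rw [show j + 2 + m - 1 = j + m + 1 by omega, Nat.fib_add]
  rw [mem_setV, hsum fun k => Nat.fib (k + 1), hsum fun k => Nat.fib k, e1, e2]
  exact ⟨rfl, rfl⟩

/-- `𝓥_n` contains the unit vector of position `n`. -/
lemma single_mem_setV {N n : ℕ} (hn : 1 ≤ n) (hnN : n ≤ N) :
    Pi.single (⟨n - 1, by omega⟩ : Fin N) 1 ∈ setV N n := by
  rw [mem_setV]
  simp [Pi.single_apply, Nat.sub_add_cancel hn]

lemma vecX_last {N n : ℕ} (hn : 1 ≤ n) (hnN : n ≤ N) :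
    vecX N n (n + 1) = Pi.single (⟨n - 1, by omega⟩ : Fin N) 1 := by
  funext k
  simp only [vecX, Pi.single_apply, Fin.ext_iff]
  have : (k : ℕ) + 2 = n + 1 ↔ (k : ℕ) = n - 1 := by omega
  simp only [this]
  split_ifs <;> first | omega | simp

lemma setV_one_subset_setS {N : ℕ} (hN : 1 ≤ N) : setV N 1 ⊆ setS N 1 := by
  intro x hx
  simp only [setS, if_true, Set.mem_singleton_iff]
  rw [vecX_last le_rfl hN]
  obtain ⟨h1, h2⟩ := mem_setV.1 hx
  have h0 : ∀ i : Fin N, (i : ℕ) ≠ 0 → x i = 0 := fun i hi => by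
    rw [Nat.sub_self, Nat.fib_zero, Finset.sum_eq_zero_iff] at h2
    have := h2 i (Finset.mem_univ i)
    have hf := Nat.fib_pos.2 (Nat.pos_of_ne_zero hi)
    simpa [hf.ne'] using this
  let a : Fin N := ⟨0, hN⟩
  have ha : x a = 1 := by
    rw [Fintype.sum_eq_single a fun i hi => by rw [h0 i fun h => hi (Fin.ext h), mul_zero]] at h1
    simpa [a] using h1
  funext k
  by_cases hk : (k : ℕ) = 0
  · have : k = a := Fin.ext hk
    rw [this, ha]
    simp [a]
  · rw [h0 k hk, Pi.single_apply, if_neg (by simpa [Fin.ext_iff] using hk)]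

lemma setS_subset_setV {N n : ℕ} (hn : 1 ≤ n) (hnN : n ≤ N) : setS N n ⊆ setV N n := by
  rw [setS]
  split_ifs with h
  · subst h
    rintro _ rfl
    rw [vecX_last le_rfl hnN]
    exact single_mem_setV le_rfl hnN
  · rintro _ ⟨i, ⟨hi1, hi2⟩, rfl⟩
    obtain ⟨j, rfl⟩ := Nat.exists_eq_add_of_le' hi1
    obtain ⟨m, rfl⟩ := Nat.exists_eq_add_of_le (show j + 2 ≤ n by omega)
    exact vecX_mem_setV (by omega)

/-- An element of `𝓥_k` supported on two consecutive positions lies in `𝓢_k`. -/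
lemma mem_setS_of_support {N j k : ℕ} (hk : 1 ≤ k) (hkN : k ≤ N) (hj : j + 1 < N)
    {x : Fin N → ℕ} (hx : x ∈ setV N k)
    (hsupp : ∀ i : Fin N, (i : ℕ) ≠ j → (i : ℕ) ≠ j + 1 → x i = 0) : x ∈ setS N k := by
  rcases hk.eq_or_lt with rfl | hk2
  · exact setV_one_subset_setS hkN hx
  rw [setS, if_neg (by omega)]
  rcases lt_trichotomy k (j + 1) with hlt | rfl | hgt
  · exfalso
    let a : Fin N := ⟨j, by omega⟩
    let b : Fin N := ⟨j + 1, hj⟩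
    have h1 := (mem_setV.1 hx).1
    rw [Fintype.sum_eq_add a b (by simp [a, b]) fun i hi => by
      rw [hsupp i (fun h => hi.1 (Fin.ext h)) (fun h => hi.2 (Fin.ext h)), mul_zero]] at h1
    have hkj : Nat.fib k ≤ Nat.fib j := Nat.fib_mono (by omega)
    have hj1 : Nat.fib j < Nat.fib (j + 1) := Nat.fib_lt_fib_succ (by omega)
    have hj2 : Nat.fib (j + 1) ≤ Nat.fib (j + 1 + 1) := Nat.fib_mono (by omega)
    have hkp : 0 < Nat.fib k := Nat.fib_pos.2 (by omega)
    simp only [a, b] at h1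
    rcases Nat.eq_zero_or_pos (x ⟨j, by omega⟩) with h | h
    · rcases Nat.eq_zero_or_pos (x ⟨j + 1, hj⟩) with h' | h'
      · rw [h, h'] at h1; omega
      · nlinarith
    · nlinarith
  · refine ⟨j + 1 + 1, ⟨by omega, le_rfl⟩, ?_⟩
    obtain ⟨j, rfl⟩ : ∃ j', j = j' + 1 := ⟨j - 1, by omega⟩
    have hc : x ⟨j + 2, hj⟩ = 0 := by
      have h1 := le_fib_of_mem_setV hx ⟨j + 2, hj⟩
      have h2 := (mem_setV.1 hx).1
      by_contra hne
      have : Nat.fib (j + 2 + 1) * x ⟨j + 2, hj⟩ ≤ Nat.fib (j + 1 + 1) := by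
        rw [← h2]
        exact Finset.single_le_sum (f := fun i : Fin N => Nat.fib (i + 1) * x i)
          (fun _ _ => Nat.zero_le _) (Finset.mem_univ ⟨j + 2, hj⟩)
      have h3 : Nat.fib (j + 1 + 1) < Nat.fib (j + 2 + 1) := Nat.fib_lt_fib_succ (by omega)
      have h4 : 1 ≤ x ⟨j + 2, hj⟩ := Nat.one_le_iff_ne_zero.2 hne
      nlinarith
    refine (eq_vecX_of_mem_setV (j := j) (m := 0) (by omega) hx fun i h1 h2 => ?_).symm
    by_cases h3 : (i : ℕ) = j + 2
    · rw [← hc]; congr 1; exact Fin.ext h3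
    · exact hsupp i h2 h3
  · obtain ⟨m, rfl⟩ := Nat.exists_eq_add_of_le (show j + 2 ≤ k by omega)
    exact ⟨j + 3, ⟨by omega, by omega⟩, (eq_vecX_of_mem_setV hj hx hsupp).symm⟩

lemma le_sum_of_mem {N : ℕ} {l : List (Fin N → ℕ)} {x : Fin N → ℕ} (hx : x ∈ l) : x ≤ l.sum :=
  List.single_le_sum (fun _ _ _ => Nat.zero_le _) _ hx

lemma setS_subset_setR {N n : ℕ} (hn : 1 ≤ n) (hnN : n ≤ N) : setS N n ⊆ setR N n := by
  intro z hz
  have hzV := setS_subset_setV hn hnN hz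
  rcases hn.eq_or_lt with rfl | hn2
  · refine ⟨⟨hzV, ?_⟩, ?_⟩
    · intro j j' hjj hne
      have : z = vecX N 1 2 := by simpa [setS] using hz
      exfalso
      apply hne
      rw [this, vecX_last le_rfl hnN]
      simp [Pi.single_apply, Fin.ext_iff, hjj]
    · intro l hl _ x hx
      obtain ⟨i, hi1, hi2, hxi⟩ := hl.1 x hx
      obtain rfl : i = 1 := by omega
      exact ⟨1, le_rfl, le_rfl, setV_one_subset_setS hnN hxi⟩
  · rw [setS, if_neg (by omega)] at hz
    obtain ⟨i, ⟨hi1, hi2⟩, rfl⟩ := hz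
    obtain ⟨j, rfl⟩ := Nat.exists_eq_add_of_le' hi1
    have hsupp : ∀ k : Fin N, (k : ℕ) ≠ j → (k : ℕ) ≠ j + 1 → vecX N n (j + 3) k = 0 :=
      fun k h1 h2 => by rw [vecX, if_neg (by omega), if_neg (by omega)]
    refine ⟨⟨hzV, ?_⟩, ?_⟩
    · intro k k' hkk hne i hi
      have hk : vecX N n (j + 3) k ≠ 0 := fun h => hne (by rw [h, zero_mul])
      have hk' : ¬ ((k : ℕ) ≠ j ∧ (k : ℕ) ≠ j + 1) := fun h => hk (hsupp k h.1 h.2)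
      have hki : (k' : ℕ) < i := hi
      exact hsupp i (by omega) (by omega)
    · intro l hl _ x hx
      obtain ⟨k, hk1, hk2, hxk⟩ := hl.1 x hx
      refine ⟨k, hk1, hk2, mem_setS_of_support hk1 (hk2.trans hnN) (j := j) (by omega) hxk ?_⟩
      intro i h1 h2
      have := le_sum_of_mem hx i
      rw [hl.2, hsupp i h1 h2] at this
      exact Nat.le_zero.1 this

/-- The members of a non-trivial factorization of an element of `𝓥_n` lie outside `𝓥_n`: the
remaining members would have sum `0`. -/
lemma lt_of_mem_factorization {N n : ℕ} (hn : 1 ≤ n) {z : Fin N → ℕ} (hz : z ∈ setV N n)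
    {l : List (Fin N → ℕ)} (hl : IsFactorization n z l) (hne : l ≠ [z]) {x : Fin N → ℕ}
    (hx : x ∈ l) {i : ℕ} (hin : i ≤ n) (hxi : x ∈ setV N i) : i < n := by
  rcases hin.lt_or_eq with h | rfl
  · exact h
  exfalso
  obtain ⟨s, r, rfl⟩ := List.append_of_mem hx
  have hsum : x + (s.sum + r.sum) = z := by
    rw [← hl.2, List.sum_append, List.sum_cons]
    exact add_left_comm _ _ _
  have hrest : s.sum + r.sum = 0 := by
    have h1 := (mem_setV.1 hz).1
    rw [← hsum] at h1
    simp only [Pi.add_apply, mul_add] at h1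
    rw [Finset.sum_add_distrib, (mem_setV.1 hxi).1] at h1
    have h2 := Nat.add_eq_left.1 h1
    funext k
    have := Finset.sum_eq_zero_iff.1 h2 k (Finset.mem_univ k)
    have hf := Nat.fib_pos.2 (Nat.succ_pos (k : ℕ))
    simpa [hf.ne', ← mul_add] using this
  have hnil : ∀ y ∈ s ++ r, False := fun y hy => by
    have hy0 : y = 0 := by
      have h := le_sum_of_mem hy
      rw [List.sum_append, hrest] at h
      exact le_antisymm h fun _ => Nat.zero_le _
    obtain ⟨k, hk1, -, hk⟩ := hl.1 y (by
      rcases List.mem_append.1 hy with h | h <;> simp [h])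
    have := (mem_setV.1 hk).1
    rw [hy0] at this
    have hf := Nat.fib_pos.2 hk1
    simp at this
    omega
  have hsr := List.append_eq_nil_iff.1 (List.eq_nil_iff_forall_not_mem.2 hnil)
  apply hne
  rw [hrest, add_zero] at hsum
  rw [hsr.1, hsr.2, hsum]
  rfl

/-! ### Power sums and their minimizers -/

/-- The sum `∑ x_i c_i ^ t`; for `c_i = m(α_i)` this is `f_x(t) ^ t`. -/
noncomputable def powerSum {N : ℕ} (c : Fin N → ℝ) (t : ℝ) (x : Fin N → ℕ) : ℝ :=
  ∑ i, (x i : ℝ) * c i ^ t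

lemma powerSum_add {N : ℕ} (c : Fin N → ℝ) (t : ℝ) (x y : Fin N → ℕ) :
    powerSum c t (x + y) = powerSum c t x + powerSum c t y := by
  simp [powerSum, add_mul, Finset.sum_add_distrib]

lemma powerSum_single {N : ℕ} (c : Fin N → ℝ) (t : ℝ) (i : Fin N) :
    powerSum c t (Pi.single i 1) = c i ^ t := by
  rw [powerSum, Fintype.sum_eq_single i fun j hj => by simp [hj]]
  simp

/-- An exponential sum with distinct bases that vanishes near a point is trivial: along a short
arithmetic progression it gives a Vandermonde system. -/
lemma eq_zero_of_eventually_sum_rpow_eq_zero {N : ℕ} {c : Fin N → ℝ} (hc : ∀ i, 0 < c i)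
    (hinj : Function.Injective c) {v : Fin N → ℝ} {t₀ : ℝ}
    (h : ∀ᶠ t in 𝓝 t₀, ∑ i, v i * c i ^ t = 0) : v = 0 := by
  obtain ⟨ε, hε, hball⟩ := Metric.eventually_nhds_iff.1 h
  set δ := ε / (N + 1) with hδ
  have hδ0 : 0 < δ := by positivity
  have hw : (fun i => v i * c i ^ t₀) = 0 := by
    refine Matrix.eq_zero_of_forall_pow_sum_mul_pow_eq_zero (f := fun i => c i ^ δ) ?_ ?_
    · intro i j hij
      exact hinj (Real.rpow_left_injOn hδ0.ne' (hc i).le (hc j).le hij)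
    · intro k
      have hk : dist (t₀ + δ * k) t₀ < ε := by
        rw [Real.dist_eq, add_sub_cancel_left, abs_of_nonneg (by positivity), hδ, div_mul_eq_mul_div,
          div_lt_iff₀ (by positivity)]
        have : (k : ℝ) < N := by exact_mod_cast k.2
        nlinarith
      rw [← hball hk]
      refine Finset.sum_congr rfl fun i _ => ?_
      rw [Real.rpow_add (hc i), Real.rpow_mul (hc i).le, Real.rpow_natCast, mul_assoc]
  funext i
  have := congrFun hw i
  simpa [(Real.rpow_pos_of_pos (hc i) t₀).ne'] using this

lemma eventually_powerSum_ne {N : ℕ} {c : Fin N → ℝ} (hc : ∀ i, 0 < c i)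
    (hinj : Function.Injective c) {x y : Fin N → ℕ} (hxy : x ≠ y) (t₀ : ℝ) :
    ∀ᶠ t in 𝓝[≠] t₀, powerSum c t x ≠ powerSum c t y := by
  have han : AnalyticAt ℝ (fun t => ∑ i, ((x i : ℝ) - y i) * c i ^ t) t₀ := by
    have : (fun t : ℝ => ∑ i, ((x i : ℝ) - y i) * c i ^ t)
        = fun t => ∑ i, ((x i : ℝ) - y i) * Real.exp (Real.log (c i) * t) := by
      funext t
      simp_rw [fun i => Real.rpow_def_of_pos (hc i) t]
    rw [this]
    fun_prop
  rcases han.eventually_eq_zero_or_eventually_ne_zero with h | h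
  · refine absurd ?_ hxy
    have := eq_zero_of_eventually_sum_rpow_eq_zero hc hinj h
    funext i
    have hi := congrFun this i
    exact_mod_cast sub_eq_zero.1 hi
  · filter_upwards [h] with t ht heq
    apply ht
    simp only [sub_mul, Finset.sum_sub_distrib]
    exact sub_eq_zero.2 heq

/-- For all `t` near `t₀` other than `t₀`, the minimizer of the power sum on the finite set `V` is
unique, so it lies in `X`; since `X` is finite, one element of `X` is a minimizer for arbitrarily
close `t`, and it remains one at `t₀` by continuity. -/
lemma exists_powerSum_le {N : ℕ} {c : Fin N → ℝ} (hc : ∀ i, 0 < c i)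
    (hinj : Function.Injective c) {V X : Set (Fin N → ℕ)} (hV : V.Finite) (hne : V.Nonempty)
    (hXV : X ⊆ V)
    (hX : ∀ t : ℝ, 0 < t → ∀ z ∈ V, z ∉ X → ∃ z' ∈ V, z' ≠ z ∧ powerSum c t z' ≤ powerSum c t z)
    {t₀ : ℝ} (ht₀ : 0 < t₀) : ∃ z ∈ X, ∀ x ∈ V, powerSum c t₀ z ≤ powerSum c t₀ x := by
  have hgen : ∀ᶠ t in 𝓝[>] t₀, ∀ x ∈ V, ∀ y ∈ V, x ≠ y → powerSum c t x ≠ powerSum c t y := by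
    refine Filter.Eventually.filter_mono (nhdsWithin_mono _ fun t (ht : t₀ < t) => ht.ne') ?_
    refine (eventually_all_finite hV).2 fun x _ => (eventually_all_finite hV).2 fun y _ => ?_
    by_cases hxy : x = y
    · exact Eventually.of_forall fun _ h => absurd hxy h
    · filter_upwards [eventually_powerSum_ne hc hinj hxy t₀] with t ht _ using ht
  have hmin : ∀ᶠ t in 𝓝[>] t₀, ∃ z ∈ X, ∀ x ∈ V, powerSum c t z ≤ powerSum c t x := by
    filter_upwards [hgen, self_mem_nhdsWithin] with t ht htt
    obtain ⟨z, hz, hzmin⟩ := Set.exists_min_image V (powerSum c t) hV hne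
    refine ⟨z, ?_, hzmin⟩
    by_contra hzX
    obtain ⟨z', hz', hzz, hle⟩ := hX t (ht₀.trans htt) z hz hzX
    exact ht z' hz' z hz hzz (hle.antisymm (hzmin z' hz'))
  have hfreq : ∃ z ∈ X, ∃ᶠ t in 𝓝[>] t₀, ∀ x ∈ V, powerSum c t z ≤ powerSum c t x := by
    by_contra hcon
    have h := (eventually_all_finite (hV.subset hXV)).2 fun z hz =>
      not_frequently.1 fun hf => hcon ⟨z, hz, hf⟩
    obtain ⟨t, ⟨z, hz, hzt⟩, ht⟩ := (hmin.and h).exists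
    exact ht z hz hzt
  obtain ⟨z, hz, hzf⟩ := hfreq
  refine ⟨z, hz, fun x hx => ?_⟩
  have hcont : ∀ y : Fin N → ℕ, Continuous fun t => powerSum c t y := fun y => by
    refine continuous_finsetSum _ fun i _ => continuous_const.mul ?_
    exact Real.continuous_const_rpow (hc i).ne'
  have hlim : Tendsto (fun t => powerSum c t z - powerSum c t x) (𝓝[>] t₀)
      (𝓝 (powerSum c t₀ z - powerSum c t₀ x)) :=
    (((hcont z).sub (hcont x)).tendsto t₀).mono_left nhdsWithin_le_nhds
  exact sub_nonpos.1 (le_of_tendsto_of_frequently hlim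
    (hzf.mono fun t ht => sub_nonpos.2 (ht x hx)))

/-- A vector of integers between two bounds with prescribed sum. -/
lemma exists_sum_eq_of_le {ι : Type*} (s : Finset ι) {lo hi : ι → ℕ} (hle : ∀ i, lo i ≤ hi i)
    {H : ℕ} (h1 : ∑ i ∈ s, lo i ≤ H) (h2 : H ≤ ∑ i ∈ s, hi i) :
    ∃ g : ι → ℕ, (∀ i, lo i ≤ g i ∧ g i ≤ hi i) ∧ ∑ i ∈ s, g i = H := by
  classical
  induction s using Finset.induction_on generalizing H with
  | empty => exact ⟨lo, fun i => ⟨le_rfl, hle i⟩, by simp at h2 ⊢; omega⟩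
  | insert a s ha ih =>
    rw [Finset.sum_insert ha] at h1 h2
    have hsum : ∑ i ∈ s, lo i ≤ ∑ i ∈ s, hi i := Finset.sum_le_sum fun i _ => hle i
    have := hle a
    obtain ⟨u, hu1, hu2, hu3, hu4⟩ : ∃ u, lo a ≤ u ∧ u ≤ hi a ∧ ∑ i ∈ s, lo i + u ≤ H ∧
        H ≤ ∑ i ∈ s, hi i + u := by
      by_cases h : ∑ i ∈ s, lo i + hi a ≤ H
      · exact ⟨hi a, this, le_rfl, h, by omega⟩
      · exact ⟨H - ∑ i ∈ s, lo i, by omega, by omega, by omega, by omega⟩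
    obtain ⟨g, hg, hgs⟩ := ih (H := H - u) (by omega) (by omega)
    refine ⟨Function.update g a u, fun i => ?_, ?_⟩
    · by_cases hi : i = a
      · subst hi; simpa using ⟨hu1, hu2⟩
      · simpa [hi] using hg i
    · rw [Finset.sum_insert ha, Function.update_self,
        Finset.sum_congr rfl fun i hi => Function.update_of_ne (ne_of_mem_of_not_mem hi ha) u g,
        hgs]
      omega

/-- The cones spanned by `(h_{i+1}, h_i)` and `(h_{i+3}, h_{i+2})` are unimodular, and together they
contain all integer points `(e, f)` with `0 ≤ f ≤ e`. The shift `(e, f) ↦ (f, e - f)` moves each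
cone to the previous one. -/
lemma exists_fib_combination (e f : ℕ) (h : f ≤ e) :
    ∃ a b i : ℕ, e = a * Nat.fib (i + 1) + b * Nat.fib (i + 3) ∧
      f = a * Nat.fib i + b * Nat.fib (i + 2) := by
  induction hk : e using Nat.strong_induction_on generalizing e f with
  | _ k ih =>
    subst hk
    by_cases h2 : 2 * f ≤ e
    · refine ⟨e - 2 * f, f, 0, ?_, ?_⟩ <;> simp [show Nat.fib 3 = 2 from rfl]
      omega
    · by_cases hfe : f = e
      · exact ⟨f, 0, 1, by simp [hfe], by simp⟩
      · obtain ⟨a, b, i, h3, h4⟩ := ih f (by omega) f (e - f) (by omega) rfl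
        refine ⟨a, b, i + 1, ?_, ?_⟩
        · have e1 : Nat.fib (i + 1 + 1) = Nat.fib i + Nat.fib (i + 1) := Nat.fib_add_two
          have e2 : Nat.fib (i + 1 + 3) = Nat.fib (i + 2) + Nat.fib (i + 3) := Nat.fib_add_two
          rw [e1, e2]
          have : e = f + (e - f) := by omega
          rw [this, h4]
          nth_rw 1 [h3]
          ring
        · rw [h3]

/-- Superadditivity of `c ↦ c ^ t` for `t ≥ 1`. -/
lemma powerSum_le_rpow {N : ℕ} {c : Fin N → ℝ} (hc : ∀ i, 0 < c i) {t : ℝ} (ht : 1 ≤ t)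
    (x : Fin N → ℕ) : powerSum c t x ≤ (∑ i, (x i : ℝ) * c i) ^ t := by
  set T := ∑ i, (x i : ℝ) * c i with hT
  have hT0 : 0 ≤ T := Finset.sum_nonneg fun i _ => mul_nonneg (Nat.cast_nonneg _) (hc i).le
  rcases hT0.eq_or_lt with h0 | h0
  · have hx : ∀ i, (x i : ℝ) * c i = 0 := fun i =>
      (Finset.sum_eq_zero_iff_of_nonneg fun i _ => mul_nonneg (Nat.cast_nonneg _) (hc i).le).1
        h0.symm i (Finset.mem_univ i)
    rw [← h0, Real.zero_rpow (by linarith), powerSum]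
    refine le_of_eq (Finset.sum_eq_zero fun i _ => ?_)
    rcases mul_eq_zero.1 (hx i) with h | h
    · rw [h, zero_mul]
    · exact absurd h (hc i).ne'
  · have hsplit : ∀ u : ℝ, 0 < u → u ^ t = u * u ^ (t - 1) := fun u hu => by
      rw [← Real.rpow_one_add' hu.le (by linarith), add_sub_cancel]
    rw [hsplit T h0, powerSum]
    nth_rw 1 [hT]
    rw [Finset.sum_mul]
    refine Finset.sum_le_sum fun i _ => ?_
    rcases Nat.eq_zero_or_pos (x i) with h | h
    · simp [h]
    · rw [hsplit _ (hc i), ← mul_assoc]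
      have h1 : c i ≤ T := by
        have h2 : (x i : ℝ) * c i ≤ T := Finset.single_le_sum (f := fun i => (x i : ℝ) * c i)
          (fun i _ => mul_nonneg (Nat.cast_nonneg _) (hc i).le) (Finset.mem_univ i)
        have h3 : (1 : ℝ) ≤ x i := by exact_mod_cast h
        nlinarith [hc i]
      exact mul_le_mul_of_nonneg_left (Real.rpow_le_rpow (hc i).le h1 (by linarith))
        (mul_nonneg (Nat.cast_nonneg _) (hc i).le)

/-- Subadditivity of `c ↦ c ^ t` for `0 < t ≤ 1`. -/
lemma sum_rpow_le_sum_rpow (l : List ℝ) (hl : ∀ u ∈ l, 0 ≤ u) {t : ℝ} (ht0 : 0 < t) (ht : t ≤ 1) :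
    l.sum ^ t ≤ (l.map fun u => u ^ t).sum := by
  induction l with
  | nil => simp [ht0.ne']
  | cons a l ih =>
    rw [List.sum_cons, List.map_cons, List.sum_cons]
    have h := ih fun u hu => hl u (by simp [hu])
    have h2 := Real.rpow_add_le_add_rpow (hl a (by simp))
      (List.sum_nonneg fun u hu => hl u (List.mem_cons_of_mem a hu)) ht0.le ht
    linarith

/-! ### Compatible pairs of primes -/

lemma fibNum_eq_natCast_div (p q n : ℕ) :
    fibNum p q n = ((p ^ Nat.fib n : ℕ) : ℂ) / ((q ^ Nat.fib (n - 1) : ℕ) : ℂ) := by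
  simp [fibNum]

lemma mahler_fibNum {p q : ℕ} (hp : p.Prime) (hq : q.Prime) (hpq : p ≠ q) (n : ℕ) :
    mahler (fibNum p q n)
      = max (Nat.fib n * Real.log p) (Nat.fib (n - 1) * Real.log q) := by
  rw [fibNum_eq_natCast_div, mahler_natCast_div (pow_pos hp.pos _) (pow_pos hq.pos _)
    (Nat.Coprime.pow _ _ ((Nat.coprime_primes hp hq).2 hpq))]
  push_cast
  rw [Real.log_pow, Real.log_pow]

lemma pos_of_reverse_fib {w : ℕ → ℝ} (hw : ∀ i, w i = w (i + 1) + w (i + 2)) {M : ℕ}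
    (h0 : 0 < w M) (h1 : 0 < w (M + 1)) : ∀ i ≤ M + 1, 0 < w i := by
  induction M with
  | zero =>
    intro i hi
    interval_cases i <;> assumption
  | succ M ih =>
    intro i hi
    rcases hi.eq_or_lt with rfl | hi
    · exact h1
    · exact ih (by rw [hw M]; exact add_pos h0 h1) h0 i (by omega)

/-- The points `(h_{i+1}, h_i)`, `i < N`, lie alternately on the two sides of the line
`e log p = f log q`. -/
lemma Compatible.alternating {N p q : ℕ} (h : Compatible N p q) :
    ∀ i < N, 0 < (-1 : ℝ) ^ (i + 1) * (Nat.fib i * Real.log q - Nat.fib (i + 1) * Real.log p) := by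
  obtain ⟨hN, hp, hq, hlog, -⟩ := h
  obtain ⟨M, rfl⟩ := Nat.exists_eq_add_of_le' (show 2 ≤ N by omega)
  have hlp : 0 < Real.log p := Real.log_pos (by exact_mod_cast hp.one_lt)
  set w : ℕ → ℝ := fun i =>
    (-1 : ℝ) ^ (i + 1) * (Nat.fib i * Real.log q - Nat.fib (i + 1) * Real.log p) with hw
  have hrec : ∀ i, w i = w (i + 1) + w (i + 2) := fun i => by
    simp only [hw]
    rw [show i + 2 + 1 = i + 1 + 2 from rfl, Nat.fib_add_two (n := i + 1),
      show i + 1 + 1 = i + 2 from rfl, Nat.fib_add_two (n := i)]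
    push_cast
    ring
  have h0 : 0 < w 0 := by simpa [hw] using hlp
  have hf1 : (0 : ℝ) < Nat.fib (M + 1) := by exact_mod_cast Nat.fib_pos.2 (by omega)
  have hf0 : (0 : ℝ) < Nat.fib M := by exact_mod_cast Nat.fib_pos.2 (by omega)
  simp only [show M + 2 - 1 = M + 1 from rfl, show M + 2 - 2 = M from rfl] at hlog
  rw [div_lt_div_iff₀ hf1 hlp, div_lt_div_iff₀ hlp hf0, div_lt_div_iff₀ hf0 hlp,
    div_lt_div_iff₀ hlp hf1] at hlog
  have hends : (0 < w M ∧ 0 < w (M + 1)) ∨ (0 < -w M ∧ 0 < -w (M + 1)) := by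
    simp only [hw, pow_succ]
    rcases neg_one_pow_eq_or ℝ M with hs | hs <;> rw [hs] <;> rcases hlog with ⟨ha, hb⟩ | ⟨ha, hb⟩
    · left; constructor <;> linarith
    · right; constructor <;> linarith
    · right; constructor <;> linarith
    · left; constructor <;> linarith
  rcases hends with ⟨ha, hb⟩ | ⟨ha, hb⟩
  · exact fun i hi => pos_of_reverse_fib hrec ha hb i (by omega)
  · have := pos_of_reverse_fib (w := fun i => -w i) (fun i => by rw [hrec i]; ring) ha hb 0 (by omega)
    linarith

lemma Compatible.log_lt_log {N p q : ℕ} (h : Compatible N p q) : Real.log p < Real.log q := by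
  have := h.alternating 1 (by have := h.1; omega)
  norm_num at this
  exact this

lemma Compatible.ne {N p q : ℕ} (h : Compatible N p q) : p ≠ q := by
  rintro rfl
  exact h.log_lt_log.false

lemma Compatible.mahler_fibNum_succ {N p q : ℕ} (h : Compatible N p q) (i : ℕ) :
    mahler (fibNum p q (i + 1)) = max (Nat.fib (i + 1) * Real.log p) (Nat.fib i * Real.log q) :=
  mahler_fibNum h.2.1 h.2.2.1 h.ne (i + 1)

lemma Compatible.log_pos {N p q : ℕ} (h : Compatible N p q) : 0 < Real.log p :=
  Real.log_pos (by exact_mod_cast h.2.1.one_lt)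

lemma Compatible.mahler_fibNum_pos {N p q : ℕ} (h : Compatible N p q) (i : ℕ) :
    0 < mahler (fibNum p q (i + 1)) := by
  rw [h.mahler_fibNum_succ]
  refine lt_max_of_lt_left (mul_pos ?_ h.log_pos)
  exact_mod_cast Nat.fib_pos.2 (Nat.succ_pos i)

lemma Compatible.mahler_fibNum_lt {N p q : ℕ} (h : Compatible N p q) {i : ℕ} (hi : i + 1 < N) :
    mahler (fibNum p q (i + 1)) < mahler (fibNum p q (i + 2)) := by
  have hlp := h.log_pos
  have hlt := h.log_lt_log
  rw [h.mahler_fibNum_succ, h.mahler_fibNum_succ]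
  rcases i with _ | _ | i
  · simpa [hlt] using hlp.trans hlt
  · have := h.alternating 2 hi
    norm_num [show Nat.fib 3 = 2 from rfl] at this
    norm_num [show Nat.fib 3 = 2 from rfl]
    constructor <;> linarith
  · have h1 : (Nat.fib (i + 2) : ℝ) < Nat.fib (i + 3) := by
      exact_mod_cast Nat.fib_lt_fib_succ (by omega)
    have h2 : (Nat.fib (i + 3) : ℝ) < Nat.fib (i + 4) := by
      exact_mod_cast Nat.fib_lt_fib_succ (by omega)
    exact max_lt_max (mul_lt_mul_of_pos_right h2 hlp) (mul_lt_mul_of_pos_right h1 (hlp.trans hlt))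

lemma Compatible.mahler_fibNum_strictMono {N p q : ℕ} (h : Compatible N p q) :
    StrictMono fun i : Fin N => mahler (fibNum p q (i + 1)) := by
  have key : ∀ i j : ℕ, i < j → j < N → mahler (fibNum p q (i + 1)) < mahler (fibNum p q (j + 1)) := by
    intro i j hij
    induction j, hij using Nat.le_induction with
    | base => exact fun hN => h.mahler_fibNum_lt hN
    | succ j _ ih => exact fun hN => (ih (by omega)).trans (h.mahler_fibNum_lt hN)
  exact fun i j hij => key i j hij j.2

/-- `(a / c) ^ t + (b / c) ^ t` decreases from `2` to `0`, so it takes the value `1` once. -/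
lemma exists_rpow_crossing {a b c : ℝ} (ha : 0 < a) (hb : 0 < b) (hac : a < c) (hbc : b < c) :
    ∃ s : ℝ, {t : ℝ | 0 < t ∧ c ^ t = a ^ t + b ^ t} = {s} ∧
      (∀ t ≤ s, c ^ t ≤ a ^ t + b ^ t) ∧ ∀ t, s ≤ t → a ^ t + b ^ t ≤ c ^ t := by
  have hc : 0 < c := ha.trans hac
  have hra : 0 < a / c := div_pos ha hc
  have hrb : 0 < b / c := div_pos hb hc
  have hra1 : a / c < 1 := (div_lt_one hc).2 hac
  have hrb1 : b / c < 1 := (div_lt_one hc).2 hbc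
  set g : ℝ → ℝ := fun t => (a / c) ^ t + (b / c) ^ t with hg
  have hgdiv : ∀ t, g t = (a ^ t + b ^ t) / c ^ t := fun t => by
    simp only [hg]
    rw [Real.div_rpow ha.le hc.le, Real.div_rpow hb.le hc.le, add_div]
  have hct : ∀ t : ℝ, 0 < c ^ t := fun t => Real.rpow_pos_of_pos hc t
  have hanti : StrictAnti g := fun s t hst => add_lt_add
    (Real.rpow_lt_rpow_of_exponent_gt hra hra1 hst) (Real.rpow_lt_rpow_of_exponent_gt hrb hrb1 hst)
  have hcont : Continuous g :=
    (Real.continuous_const_rpow hra.ne').add (Real.continuous_const_rpow hrb.ne')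
  have hlim : Tendsto g atTop (𝓝 (0 + 0)) :=
    (tendsto_rpow_atTop_of_base_lt_one _ (by linarith) hra1).add
      (tendsto_rpow_atTop_of_base_lt_one _ (by linarith) hrb1)
  rw [add_zero] at hlim
  obtain ⟨T, hT0, hT⟩ := ((eventually_ge_atTop (0 : ℝ)).and
    (hlim.eventually (gt_mem_nhds one_pos))).exists
  have hg0 : g 0 = 2 := by simp [hg]; norm_num
  obtain ⟨s, ⟨hs0, -⟩, hs⟩ := intermediate_value_Icc' hT0 hcont.continuousOn
    (show (1 : ℝ) ∈ Set.Icc (g T) (g 0) from ⟨hT.le, by rw [hg0]; norm_num⟩)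
  have hspos : 0 < s := hs0.lt_of_ne fun h => by rw [← h, hg0] at hs; norm_num at hs
  refine ⟨s, ?_, fun t ht => ?_, fun t ht => ?_⟩
  · ext t
    simp only [Set.mem_ofPred_eq, Set.mem_singleton_iff]
    constructor
    · rintro ⟨-, h⟩
      apply hanti.injective
      rw [hs, hgdiv, ← h, div_self (hct t).ne']
    · rintro rfl
      refine ⟨hspos, ?_⟩
      rw [hgdiv, div_eq_one_iff_eq (hct t).ne'] at hs
      exact hs.symm
  · have := hanti.antitone ht
    rwa [hs, hgdiv, le_div_iff₀ (hct t), one_mul] at this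
  · have := hanti.antitone ht
    rwa [hs, hgdiv, div_le_iff₀ (hct t), one_mul] at this

lemma Compatible.crossing_spec {N p q : ℕ} (h : Compatible N p q) {i : ℕ} (hi : i + 2 < N) :
    (∀ t ≤ crossing p q (i + 3), mahler (fibNum p q (i + 3)) ^ t
        ≤ mahler (fibNum p q (i + 2)) ^ t + mahler (fibNum p q (i + 1)) ^ t) ∧
      ∀ t, crossing p q (i + 3) ≤ t → mahler (fibNum p q (i + 2)) ^ t
        + mahler (fibNum p q (i + 1)) ^ t ≤ mahler (fibNum p q (i + 3)) ^ t := by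
  have h1 := h.mahler_fibNum_lt (i := i) (by omega)
  have h2 := h.mahler_fibNum_lt (i := i + 1) hi
  obtain ⟨s, hs, hs1, hs2⟩ := exists_rpow_crossing (h.mahler_fibNum_pos (i + 1))
    (h.mahler_fibNum_pos i) h2 (h1.trans h2)
  have : crossing p q (i + 3) = s := by
    rw [crossing, show i + 3 - 1 = i + 2 from rfl, show i + 3 - 2 = i + 1 from rfl, hs,
      csInf_singleton]
  rw [this]
  exact ⟨hs1, hs2⟩

lemma Compatible.crossing_le {N p q : ℕ} (h : Compatible N p q) {a b : ℕ} (ha : 3 ≤ a)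
    (hab : a ≤ b) (hb : b ≤ N) : crossing p q b ≤ crossing p q a := by
  induction b, hab using Nat.le_induction with
  | base => exact le_rfl
  | succ b hab ih => exact (h.2.2.2.2 b (ha.trans hab) (by omega)).le.trans (ih (by omega))

/-- Replacing `u` by `v` in an element of `𝓥_n` when `u` and `v` have the same image. -/
lemma add_mem_setV_of_sum_eq {N n : ℕ} {r u v : Fin N → ℕ} (hz : u + r ∈ setV N n)
    (h1 : ∑ i : Fin N, Nat.fib (i + 1) * u i = ∑ i : Fin N, Nat.fib (i + 1) * v i)
    (h2 : ∑ i : Fin N, Nat.fib i * u i = ∑ i : Fin N, Nat.fib i * v i) : v + r ∈ setV N n := by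
  rw [mem_setV] at hz ⊢
  simpa [mul_add, Finset.sum_add_distrib, h1, h2] using hz

lemma sum_mul_single {N : ℕ} (g : Fin N → ℕ) (i : Fin N) :
    ∑ k, g k * (Pi.single i 1 : Fin N → ℕ) k = g i := by
  simp [Pi.single_apply]

lemma exists_add_of_pos {N : ℕ} {z : Fin N → ℕ} {i : Fin N} (hi : z i ≠ 0) :
    ∃ r : Fin N → ℕ, z = Pi.single i 1 + r := by
  refine exists_add_of_le fun k => ?_
  by_cases hk : k = i
  · subst hk; simpa using Nat.one_le_iff_ne_zero.2 hi
  · simp [hk]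

/-- An element of `𝓥_n` outside `𝓒_n` has positive coordinates at positions `j`, `j + 1` and
`i ≥ j + 2`. Up to `t = t_{j+2}` merging `α_j α_{j+1}` into `α_{j+2}` does not increase the power
sum; beyond it `t ≥ t_i`, and splitting `α_i` does not increase it. -/
lemma Compatible.exists_le_of_not_mem_setC {N p q : ℕ} (h : Compatible N p q) {n : ℕ} (t : ℝ)
    {z : Fin N → ℕ} (hz : z ∈ setV N n) (hzC : z ∉ setC N n) :
    ∃ z' ∈ setV N n, z' ≠ z ∧ powerSum (fun i : Fin N => mahler (fibNum p q (i + 1))) t z'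
      ≤ powerSum (fun i : Fin N => mahler (fibNum p q (i + 1))) t z := by
  have hex : ∃ j j' : Fin N, (j' : ℕ) = j + 1 ∧ z j * z j' ≠ 0 ∧ ∃ i : Fin N, j' < i ∧ z i ≠ 0 := by
    by_contra hcon
    refine hzC ⟨hz, fun j j' hjj hne i hi => ?_⟩
    by_contra hzi
    exact hcon ⟨j, j', hjj, hne, i, hi, hzi⟩
  obtain ⟨j, j', hjj, hne, i, hji, hzi⟩ := hex
  obtain ⟨hzj, hzj'⟩ := mul_ne_zero_iff.1 hne
  have hji' : (j : ℕ) + 2 ≤ i := by have : (j' : ℕ) < i := hji; omega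
  have hiN := i.2
  have hfib : ∀ m, Nat.fib (m + 2) = Nat.fib m + Nat.fib (m + 1) := fun m => Nat.fib_add_two
  rcases le_total t (crossing p q (j + 3)) with ht | ht
  · obtain ⟨r, hr⟩ := exists_add_of_pos hzj
    have hjne : j' ≠ j := fun h => by rw [h] at hjj; omega
    have hrj : r j' ≠ 0 := by
      rw [hr] at hzj'
      simpa [hjne] using hzj'
    obtain ⟨r', hr'⟩ := exists_add_of_pos hrj
    rw [hr', ← add_assoc] at hr
    let k : Fin N := ⟨j + 2, by omega⟩
    refine ⟨Pi.single k 1 + r', add_mem_setV_of_sum_eq (hr ▸ hz) ?_ ?_, ?_, ?_⟩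
    · simp only [Pi.add_apply, mul_add, Finset.sum_add_distrib]
      rw [sum_mul_single fun i : Fin N => Nat.fib (i + 1),
        sum_mul_single fun i : Fin N => Nat.fib (i + 1),
        sum_mul_single fun i : Fin N => Nat.fib (i + 1), hjj]
      exact (hfib (j + 1)).symm
    · simp only [Pi.add_apply, mul_add, Finset.sum_add_distrib]
      rw [sum_mul_single fun i : Fin N => Nat.fib i, sum_mul_single fun i : Fin N => Nat.fib i,
        sum_mul_single fun i : Fin N => Nat.fib i, hjj]
      exact (hfib j).symm
    · rw [hr]
      intro heq
      have := congrFun (add_right_cancel heq) j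
      simp [Pi.single_apply, k, Fin.ext_iff] at this
      omega
    · rw [hr, powerSum_add, powerSum_add, powerSum_add, powerSum_single, powerSum_single,
        powerSum_single, hjj, add_comm (mahler _ ^ t) (mahler _ ^ t)]
      exact add_le_add_left ((h.crossing_spec (by omega)).1 t ht) _
  · obtain ⟨r, hr⟩ := exists_add_of_pos hzi
    obtain ⟨m, hm⟩ := Nat.exists_eq_add_of_le' (show 2 ≤ (i : ℕ) by omega)
    let k : Fin N := ⟨m, by omega⟩
    let k' : Fin N := ⟨m + 1, by omega⟩
    refine ⟨Pi.single k' 1 + Pi.single k 1 + r, add_mem_setV_of_sum_eq (hr ▸ hz) ?_ ?_, ?_, ?_⟩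
    · simp only [Pi.add_apply, mul_add, Finset.sum_add_distrib]
      rw [sum_mul_single fun i : Fin N => Nat.fib (i + 1),
        sum_mul_single fun i : Fin N => Nat.fib (i + 1),
        sum_mul_single fun i : Fin N => Nat.fib (i + 1), hm, add_comm (Nat.fib _)]
      exact hfib (m + 1)
    · simp only [Pi.add_apply, mul_add, Finset.sum_add_distrib]
      rw [sum_mul_single fun i : Fin N => Nat.fib i, sum_mul_single fun i : Fin N => Nat.fib i,
        sum_mul_single fun i : Fin N => Nat.fib i, hm, add_comm (Nat.fib _)]
      exact hfib m
    · rw [hr]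
      intro heq
      have := congrFun (add_right_cancel heq) i
      simp [k, k', Fin.ext_iff, hm] at this
    · have hcr := h.crossing_le (show 3 ≤ (j : ℕ) + 3 by omega)
        (show (j : ℕ) + 3 ≤ m + 3 by omega) (by omega)
      rw [hr, powerSum_add, powerSum_add, powerSum_add, powerSum_single, powerSum_single,
        powerSum_single, hm]
      exact add_le_add_left ((h.crossing_spec (by omega)).2 t (hcr.trans ht)) _

/-! ### Product representations -/

lemma measureFn_nonneg (l : List ℂ) (t : ℝ) : 0 ≤ measureFn l t := by
  refine Real.rpow_nonneg (List.sum_nonneg fun u hu => ?_) _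
  obtain ⟨β, -, rfl⟩ := List.mem_map.1 hu
  exact Real.rpow_nonneg (mahler_nonneg β) t

lemma vecMeasureFn_eq {N : ℕ} (p q : ℕ) (x : Fin N → ℕ) (t : ℝ) :
    vecMeasureFn p q x t
      = powerSum (fun i : Fin N => mahler (fibNum p q (i + 1))) t x ^ (1 / t) := by
  rw [vecMeasureFn, measureFn, vecRep, powerSum, Fin.sum_univ_def]
  congr 1
  induction List.finRange N with
  | nil => simp
  | cons a l ih => simp [ih]

lemma powerSum_nonneg {N : ℕ} {c : Fin N → ℝ} (hc : ∀ i, 0 < c i) (t : ℝ) (x : Fin N → ℕ) :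
    0 ≤ powerSum c t x :=
  Finset.sum_nonneg fun i _ => mul_nonneg (Nat.cast_nonneg _) (Real.rpow_nonneg (hc i).le t)

lemma prod_vecRep {N n p q : ℕ} {x : Fin N → ℕ} (hx : x ∈ setV N n) :
    (vecRep p q x).prod = fibNum p q n := by
  have h1 : (vecRep p q x).prod = ∏ i : Fin N, fibNum p q (i + 1) ^ x i := by
    rw [vecRep, Fin.prod_univ_def]
    induction List.finRange N with
    | nil => simp
    | cons a l ih => simp [ih]
  rw [h1, fibNum, ← (mem_setV.1 hx).1, ← (mem_setV.1 hx).2, ← Finset.prod_pow_eq_pow_sum,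
    ← Finset.prod_pow_eq_pow_sum, ← Finset.prod_div_distrib]
  refine Finset.prod_congr rfl fun i _ => ?_
  rw [fibNum, div_pow, ← pow_mul, ← pow_mul, Nat.add_sub_cancel]

lemma fibNum_eq_ratCast (p q n : ℕ) :
    fibNum p q n = ((((p : ℚ) ^ Nat.fib n / (q : ℚ) ^ Nat.fib (n - 1) : ℚ)) : ℂ) := by
  simp [fibNum]

lemma vecRep_mem_productReps {N n p q : ℕ} (hp : p.Prime) (hq : q.Prime) {x : Fin N → ℕ}
    (hx : x ∈ setV N n) : vecRep p q x ∈ productReps (fibNum p q n) := by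
  refine ⟨fun β hβ => ?_, prod_vecRep hx⟩
  obtain ⟨i, -, hi⟩ := List.mem_flatMap.1 hβ
  rw [List.eq_of_mem_replicate hi]
  constructor
  · have hp0 : (p : ℂ) ≠ 0 := by exact_mod_cast hp.ne_zero
    have hq0 : (q : ℂ) ≠ 0 := by exact_mod_cast hq.ne_zero
    exact div_ne_zero (pow_ne_zero _ hp0) (pow_ne_zero _ hq0)
  · rw [fibNum_eq_ratCast]
    exact isAlgebraic_algebraMap (R := ℚ) (A := ℂ) _

lemma metricMahler_le {N n p q : ℕ} (hp : p.Prime) (hq : q.Prime) {x : Fin N → ℕ}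
    (hx : x ∈ setV N n) (t : ℝ) : metricMahler t (fibNum p q n) ≤ vecMeasureFn p q x t :=
  csInf_le ⟨0, by rintro _ ⟨l, -, rfl⟩; exact measureFn_nonneg l t⟩
    ⟨_, vecRep_mem_productReps hp hq hx, rfl⟩

/-- In a product representation of `α_n`, the constant terms carry `h_n` factors `p` and the leading
coefficients carry `h_{n-1}` factors `q`. -/
lemma fib_le_sum_padicValInt {p q n : ℕ} (hp : p.Prime) (hq : q.Prime) (hpq : p ≠ q) {l : List ℂ}
    (hl : l ∈ productReps (fibNum p q n)) :
    Nat.fib n ≤ (l.map fun β => padicValInt p ((intMinpoly β).coeff 0)).sum ∧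
      Nat.fib (n - 1) ≤ (l.map fun β => padicValInt q (intMinpoly β).leadingCoeff).sum := by
  have hpF : Fact p.Prime := ⟨hp⟩
  have hqF : Fact q.Prime := ⟨hq⟩
  have hprod := hl.2.trans (fibNum_eq_ratCast p q n)
  have h1 := (padicValRat_le_sum_of_prod_eq hl.1 hprod p).1
  have h2 := (padicValRat_le_sum_of_prod_eq hl.1 hprod q).2
  have hp0 : (p : ℚ) ≠ 0 := by exact_mod_cast hp.ne_zero
  have hq0 : (q : ℚ) ≠ 0 := by exact_mod_cast hq.ne_zero
  rw [padicValRat.div (pow_ne_zero _ hp0) (pow_ne_zero _ hq0), padicValRat.pow, padicValRat.pow,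
    padicValRat.of_nat, padicValRat.of_nat] at h1 h2
  rw [padicValNat_self, padicValNat_primes hpq] at h1
  rw [padicValNat_self, padicValNat_primes hpq.symm] at h2
  push_cast at h1 h2
  constructor <;> zify <;> linarith

/-- An integer point `(e, f)` with `f ≤ e ≤ h_N` is a combination of points `(h_{i+1}, h_i)` on one
side of the line `e log p = f log q`, where the cost `max (e log p) (f log q)` is additive. -/
lemma Compatible.exists_vector {N p q : ℕ} (h : Compatible N p q) {e f : ℕ} (hfe : f ≤ e)
    (he : e ≤ Nat.fib N) : ∃ y : Fin N → ℕ, ∑ i : Fin N, Nat.fib (i + 1) * y i = e ∧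
      ∑ i : Fin N, Nat.fib i * y i = f ∧
      ∑ i : Fin N, (y i : ℝ) * mahler (fibNum p q (i + 1))
        ≤ max (e * Real.log p) (f * Real.log q) := by
  obtain ⟨a, b, i, rfl, rfl⟩ := exists_fib_combination e f hfe
  have hN := h.1
  have hlt : ∀ m, Nat.fib (m + 1) ≤ Nat.fib N → m < N := fun m hm => by
    by_contra hcon
    have h1 : Nat.fib N < Nat.fib (N + 1) := Nat.fib_lt_fib_succ (by omega)
    have h2 : Nat.fib (N + 1) ≤ Nat.fib (m + 1) := Nat.fib_mono (by omega)
    omega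
  have hi : 0 < a → i < N := fun ha => hlt i <| by nlinarith [Nat.zero_le (b * Nat.fib (i + 3))]
  have hi2 : 0 < b → i + 2 < N := fun hb =>
    hlt (i + 2) <| by nlinarith [Nat.zero_le (a * Nat.fib (i + 1)), Nat.zero_le (Nat.fib (i + 3))]
  let y : Fin N → ℕ := fun k => if (k : ℕ) = i then a else if (k : ℕ) = i + 2 then b else 0
  have hsum : ∀ {R : Type} [CommSemiring R] (g : ℕ → R),
      ∑ k : Fin N, g k * (y k : R) = a * g i + b * g (i + 2) := by
    intro R _ g
    have hone : ∀ m u : ℕ, (0 < u → m < N) →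
        ∑ k : Fin N, g k * ((if (k : ℕ) = m then u else 0 : ℕ) : R) = u * g m := by
      intro m u hm
      rcases Nat.eq_zero_or_pos u with rfl | hu
      · simp
      · rw [Fintype.sum_eq_single ⟨m, hm hu⟩ fun k hk => by
          rw [if_neg fun hkm => hk (Fin.ext hkm), Nat.cast_zero, mul_zero]]
        simp [mul_comm]
    rw [← hone i a hi, ← hone (i + 2) b hi2, ← Finset.sum_add_distrib]
    refine Finset.sum_congr rfl fun k _ => ?_
    rw [← mul_add, ← Nat.cast_add]
    congr 2
    simp only [y]
    split_ifs <;> omega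
  refine ⟨y, ?_, ?_, ?_⟩
  · simpa using hsum fun k => Nat.fib (k + 1)
  · simpa using hsum fun k => Nat.fib k
  have hcost : ∑ k : Fin N, (y k : ℝ) * mahler (fibNum p q (k + 1))
      = a * mahler (fibNum p q (i + 1)) + b * mahler (fibNum p q (i + 2 + 1)) := by
    rw [← hsum fun k => mahler (fibNum p q (k + 1))]
    exact Finset.sum_congr rfl fun k _ => mul_comm _ _
  rw [hcost, h.mahler_fibNum_succ, h.mahler_fibNum_succ]
  -- `i` and `i + 2` have the same parity, so both maxima are attained in the same argument.
  have hside : ∀ m, m < N → 0 < (-1 : ℝ) ^ (m + 1) *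
      (Nat.fib m * Real.log q - Nat.fib (m + 1) * Real.log p) := h.alternating
  have hpow : (-1 : ℝ) ^ (i + 2 + 1) = (-1 : ℝ) ^ (i + 1) := by ring
  rcases neg_one_pow_eq_or ℝ (i + 1) with hs | hs
  · refine le_max_of_le_right ?_
    have h1 : (a : ℝ) * max (Nat.fib (i + 1) * Real.log p) (Nat.fib i * Real.log q)
        = a * (Nat.fib i * Real.log q) := by
      rcases Nat.eq_zero_or_pos a with rfl | ha
      · simp
      · have := hside i (hi ha)
        rw [hs] at this
        rw [max_eq_right (by linarith)]
    have h2 : (b : ℝ) * max (Nat.fib (i + 2 + 1) * Real.log p) (Nat.fib (i + 2) * Real.log q)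
        = b * (Nat.fib (i + 2) * Real.log q) := by
      rcases Nat.eq_zero_or_pos b with rfl | hb
      · simp
      · have := hside (i + 2) (hi2 hb)
        rw [hpow, hs] at this
        rw [max_eq_right (by linarith)]
    rw [h1, h2]
    push_cast
    exact le_of_eq (by ring)
  · refine le_max_of_le_left ?_
    have h1 : (a : ℝ) * max (Nat.fib (i + 1) * Real.log p) (Nat.fib i * Real.log q)
        = a * (Nat.fib (i + 1) * Real.log p) := by
      rcases Nat.eq_zero_or_pos a with rfl | ha
      · simp
      · have := hside i (hi ha)
        rw [hs] at this
        rw [max_eq_left (by linarith)]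
    have h2 : (b : ℝ) * max (Nat.fib (i + 2 + 1) * Real.log p) (Nat.fib (i + 2) * Real.log q)
        = b * (Nat.fib (i + 2 + 1) * Real.log p) := by
      rcases Nat.eq_zero_or_pos b with rfl | hb
      · simp
      · have := hside (i + 2) (hi2 hb)
        rw [hpow, hs] at this
        rw [max_eq_left (by linarith)]
    rw [h1, h2]
    push_cast
    exact le_of_eq (by ring)

lemma powerSum_sum {N : ℕ} {ι : Type*} (s : Finset ι) (c : Fin N → ℝ) (t : ℝ)
    (y : ι → Fin N → ℕ) : powerSum c t (∑ k ∈ s, y k) = ∑ k ∈ s, powerSum c t (y k) := by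
  classical
  induction s using Finset.induction_on with
  | empty => simp [powerSum]
  | insert a s ha ih => rw [Finset.sum_insert ha, Finset.sum_insert ha, powerSum_add, ih]

/-- The Mahler measure dominates the cost of the valuations of the extreme coefficients. -/
lemma max_padicValInt_le_mahler {p q : ℕ} (hp : p.Prime) (hq : q.Prime) {β : ℂ} (hβ0 : β ≠ 0)
    (hβ : IsAlgebraic ℚ β) :
    max (padicValInt p ((intMinpoly β).coeff 0) * Real.log p)
      (padicValInt q (intMinpoly β).leadingCoeff * Real.log q) ≤ mahler β := by
  have hpF : Fact p.Prime := ⟨hp⟩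
  have hqF : Fact q.Prime := ⟨hq⟩
  exact max_le ((padicValInt_mul_log_le (intMinpoly_coeff_zero_ne_zero β hβ hβ0)).trans
      (log_coeff_zero_le_mahler β hβ hβ0))
    ((padicValInt_mul_log_le (leadingCoeff_ne_zero.2 (intMinpoly_ne_zero β hβ))).trans
      (log_leadingCoeff_le_mahler β))

/-- Every product representation of `α_n` is dominated by one made of the `α_i`, `i ≤ N`. -/
lemma Compatible.exists_powerSum_le_of_mem_productReps {N p q : ℕ} (h : Compatible N p q) {n : ℕ}
    (hn : 1 ≤ n) (hnN : n ≤ N) {t : ℝ} (ht : 0 < t) {l : List ℂ}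
    (hl : l ∈ productReps (fibNum p q n)) :
    ∃ x ∈ setV N n, powerSum (fun i : Fin N => mahler (fibNum p q (i + 1))) t x
      ≤ (l.map fun β => mahler β ^ t).sum := by
  have hp := h.2.1
  have hq := h.2.2.1
  have hlp := h.log_pos
  have hlq := hlp.trans h.log_lt_log
  have hc : ∀ i : Fin N, 0 < mahler (fibNum p q (i + 1)) := fun i => h.mahler_fibNum_pos i
  obtain ⟨hE, hF⟩ := fib_le_sum_padicValInt hp hq h.ne hl
  have hmah : ∀ β ∈ l, max (padicValInt p ((intMinpoly β).coeff 0) * Real.log p)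
      (padicValInt q (intMinpoly β).leadingCoeff * Real.log q) ≤ mahler β := fun β hβ =>
    max_padicValInt_le_mahler hp hq (hl.1 β hβ).1 (hl.1 β hβ).2
  set E : ℂ → ℕ := fun β => padicValInt p ((intMinpoly β).coeff 0)
  set F : ℂ → ℕ := fun β => padicValInt q (intMinpoly β).leadingCoeff
  rcases le_total t 1 with ht1 | ht1
  · refine ⟨_, single_mem_setV hn hnN, ?_⟩
    have h1 := sum_rpow_le_sum_rpow (l.map mahler)
      (fun u hu => by obtain ⟨β, -, rfl⟩ := List.mem_map.1 hu; exact mahler_nonneg β) ht ht1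
    rw [List.map_map] at h1
    refine le_trans ?_ h1
    rw [powerSum_single]
    refine Real.rpow_le_rpow (hc _).le ?_ ht.le
    simp only [Nat.sub_add_cancel hn]
    rw [mahler_fibNum hp hq h.ne]
    have hsum : ∀ (G : ℂ → ℕ) (r : ℝ), (∀ β ∈ l, (G β : ℝ) * r ≤ mahler β) →
        ((l.map G).sum : ℕ) * r ≤ (l.map mahler).sum := by
      intro G r hG
      clear hE hF hmah hl h1
      induction l with
      | nil => simp
      | cons a l ih =>
        simp only [List.map_cons, List.sum_cons, Nat.cast_add, add_mul]
        exact add_le_add (hG a (by simp)) (ih fun β hβ => hG β (List.mem_cons_of_mem a hβ))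
    refine max_le ?_ ?_
    · exact (mul_le_mul_of_nonneg_right (by exact_mod_cast hE) hlp.le).trans
        (hsum E _ fun β hβ => (le_max_left _ _).trans (hmah β hβ))
    · exact (mul_le_mul_of_nonneg_right (by exact_mod_cast hF) hlq.le).trans
        (hsum F _ fun β hβ => (le_max_right _ _).trans (hmah β hβ))
  · rw [← Fin.sum_univ_fun_getElem] at hE hF ⊢
    obtain ⟨f, hf, hfs⟩ := exists_sum_eq_of_le (Finset.univ : Finset (Fin l.length))
      (lo := fun _ => 0) (hi := fun k => F l[k.1]) (fun _ => Nat.zero_le _) (by simp) hF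
    -- Choosing `f ≤ e` keeps the points in the cone covered by the Fibonacci points; it costs
    -- nothing because `log p ≤ log q`.
    obtain ⟨e, he, hes⟩ := exists_sum_eq_of_le (Finset.univ : Finset (Fin l.length))
      (lo := f) (hi := fun k => max (E l[k.1]) (f k)) (fun _ => le_max_right _ _)
      (by rw [hfs]; exact Nat.fib_mono (Nat.sub_le n 1))
      (hE.trans (Finset.sum_le_sum fun _ _ => le_max_left _ _))
    have heN : ∀ k, e k ≤ Nat.fib N := fun k =>
      (Finset.single_le_sum (fun _ _ => Nat.zero_le _) (Finset.mem_univ k)).trans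
        (hes.le.trans (Nat.fib_mono hnN))
    choose y hy1 hy2 hy3 using fun k => h.exists_vector (he k).1 (heN k)
    refine ⟨∑ k, y k, mem_setV.2 ⟨?_, ?_⟩, ?_⟩
    · rw [← hes, ← Finset.sum_congr rfl fun k _ => hy1 k, Finset.sum_comm]
      simp [Finset.mul_sum]
    · rw [← hfs, ← Finset.sum_congr rfl fun k _ => hy2 k, Finset.sum_comm]
      simp [Finset.mul_sum]
    · rw [powerSum_sum]
      refine Finset.sum_le_sum fun k _ => (powerSum_le_rpow hc ht1 (y k)).trans ?_
      refine Real.rpow_le_rpow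
        (Finset.sum_nonneg fun i _ => mul_nonneg (Nat.cast_nonneg _) (hc i).le) ?_ ht.le
      refine (hy3 k).trans (le_trans ?_ (hmah l[k.1] (List.getElem_mem _)))
      have hfF : (f k : ℝ) ≤ F l[k.1] := by exact_mod_cast (hf k).2
      have hf2 : (f k : ℝ) * Real.log q ≤ F l[k.1] * Real.log q :=
        mul_le_mul_of_nonneg_right hfF hlq.le
      refine max_le ?_ (le_max_of_le_right hf2)
      rcases le_max_iff.1 (he k).2 with h1 | h1
      · exact le_max_of_le_left (mul_le_mul_of_nonneg_right (by exact_mod_cast h1) hlp.le)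
      · refine le_max_of_le_right (le_trans ?_ hf2)
        exact mul_le_mul (by exact_mod_cast h1) h.log_lt_log.le hlp.le (Nat.cast_nonneg _)

/-- The reduction of the minimum property to exchanges inside `𝓥_n`. -/
lemma Compatible.minOver {N p q : ℕ} (h : Compatible N p q) {n : ℕ} (hn : 1 ≤ n) (hnN : n ≤ N)
    {X : Set (Fin N → ℕ)} (hXV : X ⊆ setV N n)
    (hX : ∀ t : ℝ, 0 < t → ∀ z ∈ setV N n, z ∉ X → ∃ z' ∈ setV N n, z' ≠ z ∧
      powerSum (fun i : Fin N => mahler (fibNum p q (i + 1))) t z'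
        ≤ powerSum (fun i : Fin N => mahler (fibNum p q (i + 1))) t z) :
    MinOver p q n X := by
  intro t ht
  have hc : ∀ i : Fin N, 0 < mahler (fibNum p q (i + 1)) := fun i => h.mahler_fibNum_pos i
  obtain ⟨z, hz, hzmin⟩ := exists_powerSum_le hc h.mahler_fibNum_strictMono.injective
    (setV_finite N n) ⟨_, single_mem_setV hn hnN⟩ hXV hX ht
  constructor
  · refine ⟨z, hz, le_antisymm ?_ (metricMahler_le h.2.1 h.2.2.1 (hXV hz) t)⟩
    refine le_csInf ⟨_, _, vecRep_mem_productReps h.2.1 h.2.2.1 (hXV hz), rfl⟩ ?_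
    rintro _ ⟨l, hl, rfl⟩
    obtain ⟨x, hx, hxl⟩ := h.exists_powerSum_le_of_mem_productReps hn hnN ht hl
    show vecMeasureFn p q z t ≤ measureFn l t
    rw [vecMeasureFn_eq]
    exact Real.rpow_le_rpow (powerSum_nonneg hc t z) ((hzmin x hx).trans hxl) (by positivity)
  · rintro _ ⟨x, hx, rfl⟩
    exact metricMahler_le h.2.1 h.2.2.1 (hXV hx) t

/-- An element of `𝓒_n` outside `𝓡_n` has a member `x ∈ 𝓥_i`, `i < n`, in a factorization that is
not in `𝓢_i`; exchanging it for a minimizer in `𝓢_i` does not increase the power sum. -/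
lemma Compatible.exists_le_of_not_mem_setR {N p q : ℕ} (h : Compatible N p q) {n : ℕ} (hn : 1 ≤ n)
    (hnN : n ≤ N) (hmin : ∀ i, 1 ≤ i → i < n → MinOver p q i (setS N i)) {t : ℝ} (ht : 0 < t)
    {z : Fin N → ℕ} (hz : z ∈ setV N n) (hzR : z ∉ setR N n) :
    ∃ z' ∈ setV N n, z' ≠ z ∧ powerSum (fun i : Fin N => mahler (fibNum p q (i + 1))) t z'
      ≤ powerSum (fun i : Fin N => mahler (fibNum p q (i + 1))) t z := by
  by_cases hzC : z ∈ setC N n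
  swap
  · exact h.exists_le_of_not_mem_setC t hz hzC
  have hc : ∀ i : Fin N, 0 < mahler (fibNum p q (i + 1)) := fun i => h.mahler_fibNum_pos i
  have hex : ∃ l : List (Fin N → ℕ), IsFactorization n z l ∧ l ≠ [z] ∧
      ∃ x ∈ l, ∀ i, 1 ≤ i → i ≤ n → x ∉ setS N i := by
    by_contra hcon
    refine hzR ⟨hzC, fun l hl hne x hx => ?_⟩
    by_contra hxS
    exact hcon ⟨l, hl, hne, x, hx, fun i h1 h2 h3 => hxS ⟨i, h1, h2, h3⟩⟩
  obtain ⟨l, hl, hne, x, hx, hxS⟩ := hex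
  obtain ⟨i, hi1, hin, hxi⟩ := hl.1 x hx
  have hin' := lt_of_mem_factorization hn hz hl hne hx hin hxi
  obtain ⟨⟨s, hs, hseq⟩, -⟩ := hmin i hi1 hin' t ht
  have hsx : vecMeasureFn p q s t ≤ vecMeasureFn p q x t :=
    hseq.le.trans (metricMahler_le h.2.1 h.2.2.1 hxi t)
  rw [vecMeasureFn_eq, vecMeasureFn_eq, Real.rpow_le_rpow_iff (powerSum_nonneg hc t s)
    (powerSum_nonneg hc t x) (by positivity)] at hsx
  obtain ⟨r, hr⟩ := exists_add_of_le (le_sum_of_mem hx)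
  rw [hl.2] at hr
  have hsV := mem_setV.1 (setS_subset_setV hi1 (hin.trans hnN) hs)
  have hxV := mem_setV.1 hxi
  refine ⟨s + r, add_mem_setV_of_sum_eq (hr ▸ hz) (hxV.1.trans hsV.1.symm)
    (hxV.2.trans hsV.2.symm), ?_, ?_⟩
  · rw [hr]
    intro heq
    rw [add_right_cancel heq] at hs
    exact hxS i hi1 hin hs
  · rw [hr, powerSum_add, powerSum_add]
    exact add_le_add_left hsx _

end FibMahler

theorem theorem3p1 (n N : ℕ) (hn : 1 ≤ n) (hnN : n ≤ N) :
    (FibMahler.setS N n ⊆ FibMahler.setR N n ∧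
      FibMahler.setR N n ⊆ FibMahler.setC N n ∧
      FibMahler.setC N n ⊆ FibMahler.setV N n) ∧
    ∀ p q : ℕ, FibMahler.Compatible N p q →
      FibMahler.MinOver p q n (FibMahler.setC N n) ∧
      ((∀ i, 1 ≤ i → i < n → FibMahler.MinOver p q i (FibMahler.setS N i)) →
        FibMahler.MinOver p q n (FibMahler.setR N n)) := by
  refine ⟨⟨FibMahler.setS_subset_setR hn hnN, FibMahler.setR_subset_setC N n,
    FibMahler.setC_subset_setV N n⟩, fun p q h => ⟨?_, fun hmin => ?_⟩⟩
  · exact h.minOver hn hnN (FibMahler.setC_subset_setV N n)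
      fun t _ z hz hzC => h.exists_le_of_not_mem_setC t hz hzC
  · exact h.minOver hn hnN
      ((FibMahler.setR_subset_setC N n).trans (FibMahler.setC_subset_setV N n))
      fun t ht z hz hzR => h.exists_le_of_not_mem_setR hn hnN hmin ht hz hzR
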